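/- **Setting.** Let $\|\cdot\|$ be a norm on $\mathbb R^d$ that is invariant under changing the sign of a coordinate and satisfies $\|e_j\|=1$ for every canonical basis vector; put $\kappa(x,y)=\|x-y\|$, $\mathcal B_d=\{x:\|x\|\le \frac12\}\subseteq[-\frac12,\frac12]^d$, and $\Delta=\sup\{\kappa(x,y):x,y\in[0,1)^d\}$. For a probability distribution $P$ on $\mathcal B_d$ and a set $F\subseteq\mathcal B_d$ of $k$ centers let $\kappa(x,F)=\min_{f\in F}\kappa(x,f)$, $\mathrm{cost}_P(F)=\mathbb E_{x\sim P}\,\kappa(x,F)^2$ and $\mathrm{OPT}=\inf\{\mathrm{cost}_P(F): F\subseteq\mathcal B_d,\ |F|=k\}$. A distribution $P'$ on a set $X'\subseteq\mathcal B_d$ is an *$\varepsilon$-coreset* of $P$ for $k$-means, of size $|X'|$, if $(1-\varepsilon)\,\mathrm{cost}_P(F)\le \mathrm{cost}_{P'}(F)\le(1+\varepsilon)\,\mathrm{cost}_P(F)$ for all $F\subseteq\mathcal B_d$ with $|F|=k$. An algorithm that reads $n$ i.i.d. samples and a random seed is *$\rho$-replicable* if, for every distribution on $\mathcal B_d$,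 two runs on independent samples with the same seed have the same output with probability at least $1-\rho$. **Heavy hitters.** Given target $v$, error $\eta$, parameters $\rho_0,\delta_0$ and a finite domain $D$, the routine does the following. Put $\theta=\frac{1}{v-\eta}\ln\frac{2}{\delta_0(v-\eta)}$. If $|D|<\theta$, let $\hat D=D$; otherwise let $\hat D$ be the set of values of $\lceil\theta\rceil$ samples. Draw $\left\lceil\frac{648\ln(2/\delta_0)+648(|\hat D|+1)\ln 2}{\rho_0^2\eta^2}\right\rceil$ fresh samples, choose $v'\in[v-\frac23\eta,v-\frac13\eta]$ uniformly with the shared seed, and return all $z\in\hat D$ whose empirical mass in the fresh samples is at least $v'$. **Algorithm.** The inputs are $k$, the norm, an accuracy $\varepsilon'$, an exponent $p$, $\rho$, $\delta$, and an estimate $\Lambda$ of $\mathrm{OPT}$. Let $$t=\left\lceil \tfrac1p\log_2\tfrac{5\Delta^p}{\varepsilon'\Lambda}+1\right\rceil,\qquad \gamma=\frac{\varepsilon'}{5tkM(2\Delta)^p},\qquad M=\left(\frac{2^5\Delta}{\varepsilon'}\right)^d .$$ For each $i$ divide the cube $[-\frac12,\frac12]^d$ into $2^{id}$ cells of side $2^{-i}$.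 The whole cube is heavy. For $i=1,2,\dots$, as long as there are heavy cells of level $i-1$: if $(2^{-i+1}\Delta)^p\le \varepsilon'\Lambda/5$, the children of the heavy cells of level $i-1$ are *special* and the recursion stops; otherwise, run the heavy hitters routine on fresh samples discretized to the $2^{id}$ cells of level $i$, with $v=\gamma\Lambda 2^{pi}$, $\eta=v/2$, $\rho_0=\rho/t$, $\delta_0=\delta/t$. The children of heavy cells of level $i-1$ that it returns are *heavy*, the other children are *light*. Each heavy cell $Z$ gets a representative $R'(Z)$: if $Z$ has no heavy child, $R'(Z)$ is a point of $Z$ (in $Z\cap\mathcal B_d$ if this is nonempty) chosen by a fixed data-independent rule; otherwise $R'(Z)=R'(Z')$ for a heavy child $Z'$ of $Z$ chosen by such a rule. The output is the map $R$ that sends every point of a light or special cell to the representative of the parent of that cell. **Theorem.** Let $\beta\ge1$ be an absolute constant. Let $\varepsilon,\rho\in(0,1)$ and $\delta\in(0,\rho/3)$, and let $P$ be a distribution on $\mathcal B_d$ with $\mathrm{OPT}>0$. Suppose that $\Lambda$ satisfies $\frac{1}{\beta(1+\varepsilon)}\mathrm{OPT}\le\Lambda\le(1+\varepsilon)\mathrm{OPT}$.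 Then, for any choice rules, the algorithm above, run with exponent $p=2$ and accuracy $\varepsilon'=\varepsilon^2/2^6$, is $\rho$-replicable, and with probability at least $1-\delta$ its output $R$ is such that the distribution of $R(x)$, $x\sim P$, on $R(\mathcal B_d)\subseteq\mathcal B_d$ is an $\varepsilon$-coreset of $P$ for $k$-means, of size $$|R(\mathcal B_d)|= O\!\left(\frac{k2^{11d}\Delta^{d+2}}{\varepsilon^{2d+2}}\log\frac{\Delta^2}{\varepsilon\,\mathrm{OPT}}\right).$$ Moreover, the number of samples it uses (in the worst case) is $$\tilde O\!\left(\frac{k^32^{33d}\Delta^{3d+6}}{\rho^2\varepsilon^{6d+6}\,\mathrm{OPT}^3}\log\frac1\delta\right).$$ Here $\tilde O(g)$ means at most $C g\,(\log g)^c$; the exponent $c$ is universal, and the constants hidden in $O$ and $\tilde O$ depend only on $\beta$. -/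

import Mathlib

open MeasureTheory

noncomputable section

namespace ReplicableCoreset

/-! ### The setting: sign-invariant normalized norms on `ℝ^d` and statistical clustering -/

/-- `N` is a norm on `ℝ^d` that is invariant under changing the sign of a coordinate and gives
every vector of the canonical basis length one. -/
structure IsAdmissibleNorm {d : ℕ} (N : Seminorm ℝ (Fin d → ℝ)) : Prop where
  definite : ∀ x, N x = 0 → x = 0
  sign_invariant : ∀ (x : Fin d → ℝ) (j : Fin d), N (Function.update x j (-x j)) = N x
  normalized : ∀ j : Fin d, N (Pi.single j 1) = 1

/-- The ball of diameter one about the origin for the metric `κ(x, y) = N (x - y)`. -/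
def unitDiamBall {d : ℕ} (N : Seminorm ℝ (Fin d → ℝ)) : Set (Fin d → ℝ) :=
  {x | N x ≤ 1 / 2}

/-- The diameter `Δ` of the unit hypercube. -/
def cubeDiam {d : ℕ} (N : Seminorm ℝ (Fin d → ℝ)) : ℝ :=
  sSup {r | ∃ x y : Fin d → ℝ, (∀ j, x j ∈ Set.Ico (0 : ℝ) 1) ∧ (∀ j, y j ∈ Set.Ico (0 : ℝ) 1) ∧
    r = N (x - y)}

/-- `κ(x, F)`, the distance from `x` to the nearest center of `F`. -/
def distTo {d : ℕ} (N : Seminorm ℝ (Fin d → ℝ)) (x : Fin d → ℝ) (F : Finset (Fin d → ℝ)) : ℝ :=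
  ⨅ f : F, N (x - f)

/-- The statistical cost `E_{x ∼ P} κ(x, F)^p`. -/
def cost {d : ℕ} (N : Seminorm ℝ (Fin d → ℝ)) (p : ℕ) (P : Measure (Fin d → ℝ))
    (F : Finset (Fin d → ℝ)) : ℝ :=
  ∫ x, distTo N x F ^ p ∂P

/-- The optimal value of statistical `(k, p)`-clustering. -/
def optCost {d : ℕ} (N : Seminorm ℝ (Fin d → ℝ)) (k p : ℕ) (P : Measure (Fin d → ℝ)) : ℝ :=
  sInf {c | ∃ F : Finset (Fin d → ℝ), (F : Set (Fin d → ℝ)) ⊆ unitDiamBall N ∧ F.card = k ∧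
    c = cost N p P F}

/-- The distribution `P'` on `X' ⊆ B_d` is a (strong) `ε`-coreset of `P` for
`(k, p)`-clustering. -/
structure IsCoreset {d : ℕ} (N : Seminorm ℝ (Fin d → ℝ)) (k p : ℕ) (ε : ℝ)
    (P P' : Measure (Fin d → ℝ)) (X' : Set (Fin d → ℝ)) : Prop where
  isProbability : IsProbabilityMeasure P'
  subset_ball : X' ⊆ unitDiamBall N
  concentrated : ∀ᵐ x ∂P', x ∈ X'
  cost_bounds : ∀ F : Finset (Fin d → ℝ), (F : Set (Fin d → ℝ)) ⊆ unitDiamBall N → F.card = k →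
    (1 - ε) * cost N p P F ≤ cost N p P' F ∧ cost N p P' F ≤ (1 + ε) * cost N p P F

/-- A randomized algorithm `A`, which reads a family of i.i.d. samples (indexed by the finite type
`ι`) and a random seed, is `ρ`-replicable on the domain `D`: for every distribution `Q` on `D`, two
runs on independent samples that share the seed have the same output with probability at least
`1 - ρ`. -/
def IsReplicable {S ι Ω O : Type*} [MeasurableSpace S] [Fintype ι] [MeasureSpace Ω] (D : Set S)
    (ρ : ℝ) (A : (ι → S) → Ω → O) : Prop :=
  ∀ Q : Measure S, IsProbabilityMeasure Q → (∀ᵐ x ∂Q, x ∈ D) →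
    1 - ρ ≤ (((Measure.pi fun _ : ι => Q).prod (Measure.pi fun _ : ι => Q)).prod
      (volume : Measure Ω)).real {z | A z.1.1 z.2 = A z.1.2 z.2}

/-! ### Replicable heavy hitters -/

/-- Input of the heavy hitters routine: target `v`, error `err`, replicability `rho`, confidence
`delta`. -/
structure HHParams where
  v : ℝ
  err : ℝ
  rho : ℝ
  delta : ℝ

namespace HHParams

/-- `ln (2 / (δ (v - ε))) / (v - ε)`: the size of the sample that provides the candidates. -/
def threshold (h : HHParams) : ℝ :=
  Real.log (2 / (h.delta * (h.v - h.err))) / (h.v - h.err)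

/-- The number of samples that are drawn to find candidates in a domain with `K` elements. -/
def candSize (h : HHParams) (K : ℕ) : ℕ :=
  if (K : ℝ) < h.threshold then 0 else ⌈h.threshold⌉₊

/-- An upper bound for the number of candidates. -/
def candBound (h : HHParams) (K : ℕ) : ℕ :=
  if (K : ℝ) < h.threshold then K else ⌈h.threshold⌉₊

/-- The number of samples used to estimate the masses of `m` candidates. -/
def estSize (h : HHParams) (m : ℕ) : ℕ :=
  ⌈(648 * Real.log (2 / h.delta) + 648 * ((m : ℝ) + 1) * Real.log 2) / (h.rho ^ 2 * h.err ^ 2)⌉₊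

/-- The samples of one call on a domain with `K` elements: those of the first phase and (in the
worst case) those of the second. -/
abbrev SampleIdx (h : HHParams) (K : ℕ) : Type :=
  Fin (h.candSize K) ⊕ Fin (h.estSize (h.candBound K))

variable {α : Type*} [DecidableEq α]

/-- The set of candidates: the whole domain if it is small, otherwise the observed elements. -/
def candidates (h : HHParams) (dom : Finset α) (s : h.SampleIdx dom.card → α) : Finset α :=
  if (dom.card : ℝ) < h.threshold then dom
  else Finset.univ.image fun i : Fin (h.candSize dom.card) => s (Sum.inl i)

/-- The empirical mass of `a` in the second sample, whose size depends on the number of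
candidates. -/
def empirical (h : HHParams) (dom : Finset α) (s : h.SampleIdx dom.card → α) (a : α) : ℝ :=
  ((Finset.univ.filter fun i : Fin (h.estSize (h.candBound dom.card)) =>
      (i : ℕ) < h.estSize (h.candidates dom s).card ∧ s (Sum.inr i) = a).card : ℝ) /
    h.estSize (h.candidates dom s).card

/-- Replicable heavy hitters. The seed `u`, uniform in `[0, 1]`, gives the threshold
`v' = v - 2ε/3 + u ε/3`, uniform in `[v - 2ε/3, v - ε/3]`. -/
def rHeavyHitters (h : HHParams) (dom : Finset α) (s : h.SampleIdx dom.card → α)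
    (u : unitInterval) : Finset α :=
  (h.candidates dom s).filter fun a =>
    h.v - 2 / 3 * h.err + (u : ℝ) * (h.err / 3) ≤ h.empirical dom s a

end HHParams

/-! ### Hierarchical grids -/

/-- The index of the level-`i` grid cell (of side `2^{-i}`) of the cube `[-1/2, 1/2]^d` that
contains `x`. Cells are half-open, except at the upper faces of the cube, which are included. -/
def cellIndex {d : ℕ} (i : ℕ) (x : Fin d → ℝ) : Fin d → ℕ :=
  fun j => min ⌊2 ^ i * (x j + 1 / 2)⌋₊ (2 ^ i - 1)

/-- The grid `G_i` of all `2^{id}` cells of level `i`. -/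
def grid (d i : ℕ) : Finset (Fin d → ℕ) :=
  Fintype.piFinset fun _ => Finset.range (2 ^ i)

/-- The cell of level `i` with index `a`, as a subset of the cube. -/
def cell {d : ℕ} (i : ℕ) (a : Fin d → ℕ) : Set (Fin d → ℝ) :=
  {x | (∀ j, x j ∈ Set.Icc (-(1 / 2) : ℝ) (1 / 2)) ∧ cellIndex i x = a}

/-- The `2^d` cells of level `i + 1` inside the cell `a` of level `i`. -/
def children {d : ℕ} (i : ℕ) (a : Fin d → ℕ) : Finset (Fin d → ℕ) :=
  (grid d (i + 1)).filter fun b => (fun j => b j / 2) = a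

/-- A data-independent choice rule: it picks a point of each cell (inside the ball, if the cell
meets the ball), and a member of each nonempty family of cells of a given level. -/
structure ChoiceRule {d : ℕ} (N : Seminorm ℝ (Fin d → ℝ)) where
  point : ℕ → (Fin d → ℕ) → (Fin d → ℝ)
  point_mem_cell : ∀ i, ∀ a ∈ grid d i, point i a ∈ cell i a
  point_mem_ball : ∀ i a, (cell i a ∩ unitDiamBall N).Nonempty → point i a ∈ unitDiamBall N
  pick : ℕ → Finset (Fin d → ℕ) → (Fin d → ℕ)
  pick_mem : ∀ i (S : Finset (Fin d → ℕ)), S.Nonempty → pick i S ∈ S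

theorem cell_nonempty {d i : ℕ} {a : Fin d → ℕ} (ha : a ∈ grid d i) : (cell i a).Nonempty := by
  have ha' : ∀ j, a j < 2 ^ i := by simpa [grid, Fintype.mem_piFinset] using ha
  have h2 : (0 : ℝ) < 2 ^ i := by positivity
  refine ⟨fun j => ((a j : ℝ) + 1 / 2) / 2 ^ i - 1 / 2, fun j => ⟨?_, ?_⟩, ?_⟩
  · have : (0 : ℝ) ≤ ((a j : ℝ) + 1 / 2) / 2 ^ i := by positivity
    linarith
  · have h1 : (a j : ℝ) + 1 ≤ 2 ^ i := by exact_mod_cast ha' j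
    have : ((a j : ℝ) + 1 / 2) / 2 ^ i ≤ 1 := by
      rw [div_le_one h2]; linarith
    linarith
  · funext j
    have h3 : (2 : ℝ) ^ i * (((a j : ℝ) + 1 / 2) / 2 ^ i - 1 / 2 + 1 / 2) = (a j : ℝ) + 1 / 2 := by
      field_simp
      ring
    have h4 : ⌊(a j : ℝ) + 1 / 2⌋₊ = a j := by
      rw [Nat.floor_eq_iff (by positivity)]
      constructor <;> linarith
    have h5 := ha' j
    simp only [cellIndex]
    rw [h3, h4]
    omega

open Classical in
/-- Choice rules exist. -/
instance {d : ℕ} (N : Seminorm ℝ (Fin d → ℝ)) : Nonempty (ChoiceRule N) :=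
  ⟨{ point := fun i a =>
        if h : (cell i a ∩ unitDiamBall N).Nonempty then h.some
        else if h' : (cell i a).Nonempty then h'.some else 0
     point_mem_cell := by
        intro i a ha
        by_cases h : (cell i a ∩ unitDiamBall N).Nonempty
        · rw [dif_pos h]; exact h.some_mem.1
        · rw [dif_neg h, dif_pos (cell_nonempty ha)]; exact (cell_nonempty ha).some_mem
     point_mem_ball := by
        intro i a h
        rw [dif_pos h]; exact h.some_mem.2
     pick := fun _ S => if h : S.Nonempty then h.choose else 0
     pick_mem := by
        intro i S h
        rw [dif_pos h]; exact h.choose_spec }⟩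

/-! ### The replicable coreset algorithm -/

/-- Input of the coreset algorithm: number of centers `k`, exponent `p`, the norm, accuracy `eps`,
replicability `rho`, confidence `delta` and the estimate `lam` of the optimal value. -/
structure Params (d : ℕ) where
  k : ℕ
  p : ℕ
  N : Seminorm ℝ (Fin d → ℝ)
  eps : ℝ
  rho : ℝ
  delta : ℝ
  lam : ℝ

namespace Params

variable {d : ℕ}

/-- The bound `t = ⌈(1/p) log₂ (5 Δ^p / (ε Λ)) + 1⌉` for the number of layers: it is the first
layer `i` with `(2^{-i+1} Δ)^p ≤ ε Λ / 5`. -/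
def numLayers (q : Params d) : ℕ :=
  ⌈1 / (q.p : ℝ) * Real.logb 2 (5 * cubeDiam q.N ^ q.p / (q.eps * q.lam)) + 1⌉₊

/-- `γ = ε / (5 t k M (2Δ)^p)` with `M = (2^5 Δ / ε)^d`. -/
def gamma (q : Params d) : ℝ :=
  q.eps / (5 * q.numLayers * q.k * (2 ^ 5 * cubeDiam q.N / q.eps) ^ d * (2 * cubeDiam q.N) ^ q.p)

/-- The heavy hitters call on layer `i`: target `v = γ Λ / 2^{-p i}`, error `v / 2`,
replicability `ρ / t` and confidence `δ / t`. -/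
def hh (q : Params d) (i : ℕ) : HHParams where
  v := q.gamma * q.lam * 2 ^ (q.p * i)
  err := q.gamma * q.lam * 2 ^ (q.p * i) / 2
  rho := q.rho / q.numLayers
  delta := q.delta / q.numLayers

/-- All samples: the layers `1, …, t - 1` (layer `t` consists of special cells and needs none) use
disjoint blocks of fresh samples. The component `l` belongs to layer `l + 1`. -/
abbrev SampleIdx (q : Params d) : Type :=
  (l : Fin (q.numLayers - 1)) × (q.hh (l + 1)).SampleIdx (grid d (l + 1)).card

/-- The shared randomness: one uniform number in `[0, 1]` for every heavy hitters call. -/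
abbrev Seed (q : Params d) : Type :=
  Fin (q.numLayers - 1) → unitInterval

/-- The output of the heavy hitters call on layer `l + 1`, run on the discretized samples. -/
def layerHitters (q : Params d) (s : q.SampleIdx → (Fin d → ℝ)) (r : q.Seed) (l : ℕ) :
    Finset (Fin d → ℕ) :=
  if h : l < q.numLayers - 1 then
    (q.hh (l + 1)).rHeavyHitters (grid d (l + 1))
      (fun j => cellIndex (l + 1) (s ⟨⟨l, h⟩, j⟩)) (r ⟨l, h⟩)
  else ∅

/-- The heavy cells `H[i]`. -/
def heavy (q : Params d) (s : q.SampleIdx → (Fin d → ℝ)) (r : q.Seed) : ℕ → Finset (Fin d → ℕ)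
  | 0 => {fun _ => 0}
  | i + 1 =>
    if (cubeDiam q.N / 2 ^ i) ^ q.p ≤ q.eps * q.lam / 5 then ∅
    else (heavy q s r i).biUnion (children i) ∩ q.layerHitters s r i

/-- The representative `R'(Z)` of the heavy cell `Z` with index `a` on level `i`: follow heavy
children (for at most `n` steps) down to a cell without heavy children, and choose a point
there. -/
def representative (q : Params d) (c : ChoiceRule q.N) (H : ℕ → Finset (Fin d → ℕ)) :
    ℕ → ℕ → (Fin d → ℕ) → (Fin d → ℝ)
  | 0, i, a => c.point i a
  | n + 1, i, a =>
    if children i a ∩ H (i + 1) = ∅ then c.point i a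
    else representative q c H n (i + 1) (c.pick (i + 1) (children i a ∩ H (i + 1)))

/-- The replicable coreset algorithm. Its output is the map `R`: a point `x` lies in a unique light
or special cell whose parent is heavy, and is sent to the representative of this parent, which is
the smallest heavy cell that contains `x`. -/
def rCoreset (q : Params d) (c : ChoiceRule q.N) (s : q.SampleIdx → (Fin d → ℝ)) (r : q.Seed) :
    (Fin d → ℝ) → (Fin d → ℝ) :=
  fun x =>
    let H := q.heavy s r
    let i := Nat.findGreatest (fun j => cellIndex j x ∈ H j) q.numLayers
    q.representative c H q.numLayers i (cellIndex i x)

/-- The number of samples that the algorithm reads. -/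
def sampleComplexity (q : Params d) : ℕ :=
  Fintype.card q.SampleIdx

end Params

/-- The coreset algorithm for `k`-means: exponent `p = 2`, run with accuracy `ε^2 / 2^6`. -/
def kMeansParams {d : ℕ} (k : ℕ) (N : Seminorm ℝ (Fin d → ℝ)) (ε ρ δ lam : ℝ) : Params d where
  k := k
  p := 2
  N := N
  eps := ε ^ 2 / 2 ^ 6
  rho := ρ
  delta := δ
  lam := lam

end ReplicableCoreset

end

open ReplicableCoreset

noncomputable section
namespace ReplicableCoreset

/-! ### Admissible norms -/

section Norm

variable {d : ℕ} {N : Seminorm ℝ (Fin d → ℝ)}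

/-! Coreset property. R moves x inside the smallest heavy cell around x, of level i say, hence by at
most Δ/2^i. Fix k centers F. There are three cases: (Δ/2^i)² ≤ ε'Λ/5; or x is farther from F than
4/ε' times Δ/2^i, and the squared movement is at most (ε'/5) κ(x,F)²; or the child cell of x is
light and near F. A packing bound (`card_nearCells_le`) allows at most kM cells of the third kind
per layer, each of mass below γΛ4^(i+1), and γ is chosen so that over all t layers they contribute
at most ε'Λ/5. As Λ ≤ 2 OPT, the expected squared movement is at most ε' cost(F)
(`integral_sq_map_sub_toRep_le`). Since |b² - a²| ≤ s a² + (1 + 1/s)(b - a)², the value ε' = ε²/64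
suffices (`isCoreset_map_toRep`).

Size. The values of R are points chosen in leaves, that is, heavy cells without heavy children, and
leaves are pairwise disjoint. Take F of cost at most 2 OPT. Leaves near F are few by packing. Any
other leaf, of level j, has mass at least γΛ4^j/2 at distance at least Δ/2^j from F, so it
contributes at least γΛΔ²/2 to the cost (`card_leaves_le`).

Replicability. With high probability the samples of a heavy hitters call are `Good`: all values of
mass at least v - η are candidates, and the empirical masses have total error below ρ₀η/18 over the
candidates. For two good samples the outputs differ only if the random threshold separates the two
empirical masses of a common candidate, which has probability at most ρ₀/3 (`Good.volume_ne_le`).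
Bad samples cost 2δ₀ ≤ 2ρ₀/3, and a union bound over the layers concludes (`isReplicable_rCoreset`).
Goodness of all layers of one run also yields `IsHeavyTree`, on which the coreset and size arguments
rest. -/

theorem IsAdmissibleNorm.map_flip (hN : IsAdmissibleNorm N) (x : Fin d → ℝ) (S : Finset (Fin d)) :
    N (fun i => if i ∈ S then -x i else x i) = N x := by
  induction S using Finset.induction_on with
  | empty => simp
  | insert a S ha ih =>
    rw [← ih, ← hN.sign_invariant _ a]
    congr 1
    funext i
    by_cases h : i = a
    · subst h; simp [ha]
    · simp [h]

theorem IsAdmissibleNorm.map_single (hN : IsAdmissibleNorm N) (j : Fin d) (a : ℝ) :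
    N (Pi.single j a) = |a| := by
  have : (Pi.single j a : Fin d → ℝ) = a • Pi.single j 1 := by
    rw [← Pi.single_smul]; simp
  rw [this, map_smul_eq_mul, hN.normalized, mul_one, Real.norm_eq_abs]

/-- Adding to x its reflection in all coordinates other than j leaves 2 x_j e_j, and the reflection
has the same norm. -/
theorem IsAdmissibleNorm.abs_apply_le (hN : IsAdmissibleNorm N) (x : Fin d → ℝ) (j : Fin d) :
    |x j| ≤ N x := by
  have h1 := hN.map_flip x (Finset.univ.erase j)
  have h2 : (fun i => if i ∈ Finset.univ.erase j then -x i else x i) + x =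
      Pi.single j (2 * x j) := by
    funext i
    by_cases h : i = j
    · subst h; simp; ring
    · simp [h]
  have h3 := map_add_le_add N (fun i => if i ∈ Finset.univ.erase j then -x i else x i) x
  rw [h1, h2, hN.map_single, abs_mul, abs_two] at h3
  linarith

theorem IsAdmissibleNorm.le_sum_abs (hN : IsAdmissibleNorm N) (x : Fin d → ℝ) :
    N x ≤ ∑ j, |x j| := by
  calc N x = N (∑ j, Pi.single j (x j)) := by rw [Finset.univ_sum_single]
    _ ≤ ∑ j, N (Pi.single j (x j)) := Finset.le_sum_of_subadditive N (map_zero N).le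
        (map_add_le_add N) _ _
    _ = ∑ j, |x j| := by simp_rw [hN.map_single]

theorem IsAdmissibleNorm.continuous (hN : IsAdmissibleNorm N) : Continuous N := by
  have hb : Continuous fun x : Fin d → ℝ => ∑ j, |x j| := by fun_prop
  refine continuous_iff_continuousAt.2 fun x => ?_
  have h0 : Filter.Tendsto (fun y : Fin d → ℝ => ∑ j, |(y - x) j|) (nhds x) (nhds 0) := by
    have : Continuous fun y : Fin d → ℝ => ∑ j, |(y - x) j| := by fun_prop
    simpa using this.tendsto x
  refine tendsto_iff_dist_tendsto_zero.2 (squeeze_zero (fun _ => dist_nonneg) (fun y => ?_) h0)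
  refine le_trans ?_ (hN.le_sum_abs (y - x))
  rw [Real.dist_eq]
  exact abs_sub_map_le_sub N y x

theorem mem_cube_of_mem_unitDiamBall (hN : IsAdmissibleNorm N) {x : Fin d → ℝ}
    (hx : x ∈ unitDiamBall N) (j : Fin d) : x j ∈ Set.Icc (-(1 / 2) : ℝ) (1 / 2) :=
  abs_le.1 ((hN.abs_apply_le x j).trans hx)

theorem bddAbove_cubeDiam (hN : IsAdmissibleNorm N) :
    BddAbove {r | ∃ x y : Fin d → ℝ, (∀ j, x j ∈ Set.Ico (0 : ℝ) 1) ∧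
      (∀ j, y j ∈ Set.Ico (0 : ℝ) 1) ∧ r = N (x - y)} := by
  refine ⟨d, ?_⟩
  rintro r ⟨x, y, hx, hy, rfl⟩
  refine (hN.le_sum_abs _).trans ?_
  calc ∑ j, |(x - y) j| ≤ ∑ _j : Fin d, (1 : ℝ) := by
        refine Finset.sum_le_sum fun j _ => ?_
        rw [Pi.sub_apply, abs_le]
        have h1 := hx j
        have h2 := hy j
        constructor <;> linarith [h1.1, h1.2, h2.1, h2.2]
    _ = d := by simp

/-- A vector whose coordinates are at most `s` has norm at most `s Δ`. -/
theorem map_le_mul_cubeDiam (hN : IsAdmissibleNorm N) {z : Fin d → ℝ} {s : ℝ} (hs : 0 < s)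
    (hz : ∀ j, |z j| ≤ s) : N z ≤ s * cubeDiam N := by
  -- The cube in `cubeDiam` is half-open, so z/s itself need not be a difference of two of its
  -- points. After shrinking by c < 1 its positive and negative parts lie in the cube; then c tends
  -- to 1.
  have key : ∀ c ∈ Set.Ioo (0 : ℝ) 1, c * N z ≤ s * cubeDiam N := by
    intro c hc
    have hw : ∀ j, |c / s * z j| < 1 := by
      intro j
      rw [abs_mul, abs_of_pos (div_pos hc.1 hs), div_mul_eq_mul_div, div_lt_one hs]
      calc c * |z j| ≤ c * s := by gcongr; exacts [hc.1.le, hz j]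
        _ < s := by nlinarith [hc.2]
    have h1 : N ((c / s) • z) ≤ cubeDiam N := by
      refine le_csSup (bddAbove_cubeDiam hN)
        ⟨fun j => max (c / s * z j) 0, fun j => max (-(c / s * z j)) 0, fun j => ⟨le_max_right _ _,
          max_lt ?_ one_pos⟩, fun j => ⟨le_max_right _ _, max_lt ?_ one_pos⟩, ?_⟩
      · exact (abs_lt.1 (hw j)).2
      · linarith [(abs_lt.1 (hw j)).1]
      · congr 1
        funext j
        simp only [Pi.smul_apply, smul_eq_mul, Pi.sub_apply]
        rcases le_total 0 (c / s * z j) with h | h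
        · rw [max_eq_left h, max_eq_right (by linarith)]; ring
        · rw [max_eq_right h, max_eq_left (by linarith)]; ring
    rw [map_smul_eq_mul, Real.norm_eq_abs, abs_of_pos (div_pos hc.1 hs), div_mul_eq_mul_div,
      div_le_iff₀ hs] at h1
    linarith
  have hlim : Filter.Tendsto (fun c : ℝ => c * N z) (nhdsWithin 1 (Set.Iio 1)) (nhds (1 * N z)) :=
    ((continuous_id.mul continuous_const).tendsto 1).mono_left nhdsWithin_le_nhds
  rw [one_mul] at hlim
  refine le_of_tendsto hlim ?_
  filter_upwards [Ioo_mem_nhdsLT (zero_lt_one' ℝ)] with c hc using key c hc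

theorem one_le_cubeDiam (hN : IsAdmissibleNorm N) (hd : 0 < d) : 1 ≤ cubeDiam N := by
  have := map_le_mul_cubeDiam hN (z := Pi.single ⟨0, hd⟩ 1) one_pos (fun j => by
    by_cases h : j = ⟨0, hd⟩
    · subst h; simp
    · simp [h])
  rwa [hN.normalized, one_mul] at this

end Norm

/-! ### Distance to a set of centers -/

section Dist

variable {d : ℕ} {N : Seminorm ℝ (Fin d → ℝ)} {F : Finset (Fin d → ℝ)}

theorem distTo_nonneg (x : Fin d → ℝ) : 0 ≤ distTo N x F :=
  Real.iInf_nonneg fun _ => apply_nonneg N _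

theorem distTo_le (x : Fin d → ℝ) {f : Fin d → ℝ} (hf : f ∈ F) : distTo N x F ≤ N (x - f) :=
  ciInf_le (f := fun f : F => N (x - f)) (Set.finite_range _).bddBelow ⟨f, hf⟩

theorem exists_distTo_eq (hF : F.Nonempty) (x : Fin d → ℝ) : ∃ f ∈ F, distTo N x F = N (x - f) := by
  have : Nonempty F := hF.to_subtype
  obtain ⟨f, hf⟩ := exists_eq_ciInf_of_finite (f := fun f : F => N (x - f))
  exact ⟨f, f.2, hf.symm⟩

theorem distTo_le_add (hF : F.Nonempty) (x y : Fin d → ℝ) :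
    distTo N x F ≤ distTo N y F + N (x - y) := by
  obtain ⟨f, hf, h⟩ := exists_distTo_eq (N := N) hF y
  have h1 := distTo_le (N := N) x hf
  have h2 : x - f = (x - y) + (y - f) := by abel
  have h3 := map_add_le_add N (x - y) (y - f)
  rw [← h2] at h3
  linarith

theorem measurable_distTo (hN : IsAdmissibleNorm N) (F : Finset (Fin d → ℝ)) :
    Measurable fun x => distTo N x F := by
  refine Measurable.iInf fun f => ?_
  exact (hN.continuous.comp (continuous_id.sub continuous_const)).measurable

theorem map_sub_le_one {x y : Fin d → ℝ} (hx : x ∈ unitDiamBall N) (hy : y ∈ unitDiamBall N) :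
    N (x - y) ≤ 1 := by
  have h := map_sub_le_add N x y
  have h1 : N x ≤ 1 / 2 := hx
  have h2 : N y ≤ 1 / 2 := hy
  linarith

theorem distTo_le_one (hF : F.Nonempty) (hFB : (F : Set (Fin d → ℝ)) ⊆ unitDiamBall N)
    {x : Fin d → ℝ} (hx : x ∈ unitDiamBall N) : distTo N x F ≤ 1 := by
  obtain ⟨f, hf⟩ := hF
  exact (distTo_le x hf).trans (map_sub_le_one hx (hFB hf))

end Dist

/-! ### Cells of the hierarchical grids -/

section Cells

variable {d : ℕ}

theorem cellIndex_mem_grid (i : ℕ) (x : Fin d → ℝ) : cellIndex i x ∈ grid d i := by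
  simp only [grid, Fintype.mem_piFinset, Finset.mem_range, cellIndex]
  intro j
  have : 0 < 2 ^ i := by positivity
  omega

theorem cellIndex_zero (x : Fin d → ℝ) : cellIndex 0 x = fun _ => 0 := by
  funext j; simp [cellIndex]

/-- The grids are nested: halving commutes with the floor and turns the cap 2^(i+1) - 1 into 2^i -
1, so the closed upper faces cause no exception. -/
theorem cellIndex_succ_div (i : ℕ) (x : Fin d → ℝ) :
    (fun j => cellIndex (i + 1) x j / 2) = cellIndex i x := by
  funext j
  have h := Nat.floor_div_natCast (2 ^ (i + 1) * (x j + 1 / 2)) 2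
  have h2 : 2 ^ (i + 1) * (x j + 1 / 2) / ((2 : ℕ) : ℝ) = 2 ^ i * (x j + 1 / 2) := by
    push_cast; ring
  rw [h2] at h
  simp only [cellIndex]
  have : 0 < 2 ^ i := by positivity
  rw [pow_succ 2 i] at *
  rw [h]
  omega

theorem mem_children_iff {i : ℕ} {a b : Fin d → ℕ} :
    b ∈ children i a ↔ b ∈ grid d (i + 1) ∧ (fun j => b j / 2) = a := by
  simp [children]

theorem cellIndex_succ_mem_children (i : ℕ) (x : Fin d → ℝ) :
    cellIndex (i + 1) x ∈ children i (cellIndex i x) :=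
  mem_children_iff.2 ⟨cellIndex_mem_grid _ _, cellIndex_succ_div i x⟩

theorem measurable_cellIndex (i : ℕ) : Measurable (cellIndex i : (Fin d → ℝ) → Fin d → ℕ) := by
  refine measurable_pi_iff.2 fun j => ?_
  refine Measurable.min (Nat.measurable_floor.comp ?_) measurable_const
  exact ((measurable_pi_apply j).add_const _).const_mul _

/-- The upper bound is not strict because the last cell includes the upper face of the cube. -/
theorem cellIndex_bounds (i : ℕ) {x : Fin d → ℝ} {j : Fin d}
    (hx : x j ∈ Set.Icc (-(1 / 2) : ℝ) (1 / 2)) :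
    (cellIndex i x j : ℝ) ≤ 2 ^ i * (x j + 1 / 2) ∧
      2 ^ i * (x j + 1 / 2) ≤ cellIndex i x j + 1 := by
  have h0 : (0 : ℝ) ≤ 2 ^ i * (x j + 1 / 2) := mul_nonneg (by positivity) (by linarith [hx.1])
  have h1 : 2 ^ i * (x j + 1 / 2) ≤ (2 : ℝ) ^ i := by
    have : (0 : ℝ) < 2 ^ i := by positivity
    nlinarith [hx.2]
  have h2 := Nat.floor_le h0
  have h3 := (Nat.lt_floor_add_one (2 ^ i * (x j + 1 / 2))).le
  simp only [cellIndex]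
  rcases le_total ⌊2 ^ i * (x j + 1 / 2)⌋₊ (2 ^ i - 1) with h | h
  · rw [min_eq_left h]; exact ⟨h2, h3⟩
  · rw [min_eq_right h]
    have h4 : ((2 ^ i - 1 : ℕ) : ℝ) + 1 = 2 ^ i := by
      have : 1 ≤ 2 ^ i := Nat.one_le_two_pow
      exact_mod_cast Nat.sub_add_cancel this
    refine ⟨le_trans ?_ h2, by linarith⟩
    exact_mod_cast h

/-- The diameter of a cell of level `i` is at most `2^{-i} Δ`. -/
theorem map_sub_le_of_cellIndex_eq {N : Seminorm ℝ (Fin d → ℝ)} (hN : IsAdmissibleNorm N) {i : ℕ}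
    {x y : Fin d → ℝ} (hx : ∀ j, x j ∈ Set.Icc (-(1 / 2) : ℝ) (1 / 2))
    (hy : ∀ j, y j ∈ Set.Icc (-(1 / 2) : ℝ) (1 / 2)) (h : cellIndex i x = cellIndex i y) :
    N (x - y) ≤ cubeDiam N / 2 ^ i := by
  have hp : (0 : ℝ) < 2 ^ i := by positivity
  have := map_le_mul_cubeDiam hN (z := x - y) (s := 1 / 2 ^ i) (by positivity) (fun j => by
    obtain ⟨h1, h2⟩ := cellIndex_bounds i (hx j)
    obtain ⟨h3, h4⟩ := cellIndex_bounds i (hy j)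
    rw [h] at h1 h2
    rw [le_div_iff₀ hp, Pi.sub_apply]
    calc |x j - y j| * 2 ^ i = |(x j - y j) * 2 ^ i| := by rw [abs_mul, abs_of_pos hp]
      _ ≤ 1 := abs_le.2 ⟨by linarith, by linarith⟩)
  rwa [div_mul_eq_mul_div, one_mul] at this

open Classical in
/-- The cells of level `i` that contain a point at distance at most `r` from `F`. -/
def nearCells (N : Seminorm ℝ (Fin d → ℝ)) (F : Finset (Fin d → ℝ)) (i : ℕ) (r : ℝ) :
    Finset (Fin d → ℕ) :=
  (grid d i).filter fun b => ∃ x, (∀ j, x j ∈ Set.Icc (-(1 / 2) : ℝ) (1 / 2)) ∧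
    cellIndex i x = b ∧ ∃ f ∈ F, N (x - f) ≤ r

theorem card_Icc_floor_le {u w : ℝ} (hw : 0 ≤ w) :
    ((Finset.Icc ⌈u - w⌉₊ ⌊u + w⌋₊).card : ℝ) ≤ 2 * w + 1 := by
  rw [Nat.card_Icc]
  rcases le_or_gt ⌈u - w⌉₊ (⌊u + w⌋₊ + 1) with h | h
  · rw [Nat.cast_sub h]
    push_cast
    have h1 := Nat.le_ceil (u - w)
    rcases le_or_gt 0 (u + w) with h0 | h0
    · have h2 := Nat.floor_le h0
      linarith
    -- The truncated floor is 0 here, so at most the single index 0 is counted.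
    · rw [Nat.floor_of_nonpos h0.le]
      have : (0 : ℝ) ≤ (⌈u - w⌉₊ : ℝ) := by positivity
      push_cast
      linarith
  · rw [Nat.sub_eq_zero_of_le h.le]
    push_cast; linarith

/-- Packing: coordinates are bounded by the norm, so each index of a near cell is within 2^i r + 1
of the rescaled coordinate of some center, where the extra 1 is the side of a cell. This leaves at
most 2(2^i r + 1) + 1 values per coordinate. -/
theorem card_nearCells_le {N : Seminorm ℝ (Fin d → ℝ)} (hN : IsAdmissibleNorm N)
    (F : Finset (Fin d → ℝ)) (i : ℕ) {r : ℝ} (hr : 0 ≤ r) :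
    ((nearCells N F i r).card : ℝ) ≤ F.card * (2 * (2 ^ i * r) + 3) ^ d := by
  classical
  have hp : (0 : ℝ) < 2 ^ i := by positivity
  set B : (Fin d → ℝ) → Finset (Fin d → ℕ) := fun f => Fintype.piFinset fun j =>
    Finset.Icc ⌈2 ^ i * (f j + 1 / 2) - (2 ^ i * r + 1)⌉₊
      ⌊2 ^ i * (f j + 1 / 2) + (2 ^ i * r + 1)⌋₊ with hB
  have hsub : nearCells N F i r ⊆ F.biUnion B := by
    intro b hb
    simp only [nearCells, Finset.mem_filter] at hb
    obtain ⟨-, x, hx, rfl, f, hf, hxf⟩ := hb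
    refine Finset.mem_biUnion.2 ⟨f, hf, Fintype.mem_piFinset.2 fun j => ?_⟩
    obtain ⟨h1, h2⟩ := cellIndex_bounds i (hx j)
    have h3 := abs_le.1 ((hN.abs_apply_le (x - f) j).trans hxf)
    simp only [Pi.sub_apply] at h3
    have h4 : 2 ^ i * (x j - f j) ≤ 2 ^ i * r := by gcongr; exact h3.2
    have h5 : 2 ^ i * (-r) ≤ 2 ^ i * (x j - f j) := by gcongr; exact h3.1
    rw [Finset.mem_Icc]
    exact ⟨Nat.ceil_le.2 (by linarith), Nat.le_floor (by linarith)⟩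
  have hcard : ∀ f ∈ F, ((B f).card : ℝ) ≤ (2 * (2 ^ i * r) + 3) ^ d := by
    intro f _
    rw [hB]
    simp only [Fintype.card_piFinset, Nat.cast_prod]
    refine (Finset.prod_le_prod (fun _ _ => by positivity)
      (fun j _ => (card_Icc_floor_le (by positivity)).trans (le_of_eq
        (show 2 * (2 ^ i * r + 1) + 1 = 2 * (2 ^ i * r) + 3 by ring)))).trans ?_
    simp
  calc ((nearCells N F i r).card : ℝ) ≤ ((F.biUnion B).card : ℝ) := by
        exact_mod_cast Finset.card_le_card hsub
    _ ≤ ∑ f ∈ F, ((B f).card : ℝ) := by exact_mod_cast Finset.card_biUnion_le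
    _ ≤ ∑ f ∈ F, (2 * (2 ^ i * r) + 3) ^ d := Finset.sum_le_sum hcard
    _ = F.card * (2 * (2 ^ i * r) + 3) ^ d := by simp

end Cells


/-! ### Concentration of empirical masses -/

section Concentration

open ProbabilityTheory

/-- The sign pattern `1` on `A`, `-1` on the rest of `D`, and `0` outside `D`. -/
def signFun {α : Type*} [DecidableEq α] (D A : Finset α) (y : α) : ℝ :=
  ∑ z ∈ D, if y = z then (if z ∈ A then (1 : ℝ) else -1) else 0

variable {α : Type*}

theorem abs_signFun_le [DecidableEq α] (D A : Finset α) (y : α) : |signFun D A y| ≤ 1 := by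
  rw [signFun, Finset.sum_ite_eq]
  split_ifs <;> simp

variable [MeasurableSpace α] [MeasurableSingletonClass α]

theorem integral_signFun [DecidableEq α] (p : Measure α) [IsProbabilityMeasure p] (D A : Finset α) :
    ∫ y, signFun D A y ∂p = ∑ z ∈ D, (if z ∈ A then (1 : ℝ) else -1) * p.real {z} := by
  have h : ∀ z : α, (fun y => if y = z then (if z ∈ A then (1 : ℝ) else -1) else 0) =
      Set.indicator {z} fun _ => (if z ∈ A then (1 : ℝ) else -1) := by
    intro z; funext y; simp [Set.indicator_apply]
  simp only [signFun]
  rw [integral_finsetSum]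
  · refine Finset.sum_congr rfl fun z _ => ?_
    rw [h, integral_indicator_const _ (measurableSet_singleton z), smul_eq_mul, mul_comm]
  · intro z _
    rw [h]
    exact (integrable_const _).indicator (measurableSet_singleton z)

theorem card_filter_fin_lt {n b : ℕ} (h : n ≤ b) :
    (Finset.univ.filter fun i : Fin b => (i : ℕ) < n).card = n := by
  rw [Fin.card_filter_val_lt]
  exact min_eq_right h

/-- Hoeffding: values in [-1, 1] are sub-Gaussian with parameter ((1 + 1)/2)² = 1. Only n of the b
samples enter because heavy hitters reserve samples for the worst case and use fewer when there are
fewer candidates. -/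
theorem measure_signFun_sum_le [DecidableEq α] [Countable α] (p : Measure α) [IsProbabilityMeasure p] (D A : Finset α) {n b : ℕ}
    (hnb : n ≤ b) {r : ℝ} (hr : 0 ≤ r) :
    (Measure.pi fun _ : Fin b => p).real
      {s | r ≤ ∑ i ∈ Finset.univ.filter (fun i : Fin b => (i : ℕ) < n),
        (signFun D A (s i) - ∫ y, signFun D A y ∂p)} ≤ Real.exp (-r ^ 2 / (2 * n)) := by
  have hm : Measurable (signFun D A) := measurable_of_countable _
  have hindep : iIndepFun (fun (i : Fin b) (s : Fin b → α) =>
      signFun D A (s i) - ∫ y, signFun D A y ∂p) (Measure.pi fun _ : Fin b => p) :=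
    iIndepFun_pi (X := fun _ y => signFun D A y - ∫ y, signFun D A y ∂p)
      fun _ => (hm.sub_const _).aemeasurable
  have hsub : ∀ i : Fin b, HasSubgaussianMGF (fun s : Fin b → α =>
      signFun D A (s i) - ∫ y, signFun D A y ∂p) 1 (Measure.pi fun _ : Fin b => p) := by
    intro i
    have h1 := hasSubgaussianMGF_of_mem_Icc (μ := Measure.pi fun _ : Fin b => p)
      (X := fun s : Fin b → α => signFun D A (s i)) (a := -1) (b := 1)
      (hm.comp (measurable_pi_apply i)).aemeasurable
      (Filter.Eventually.of_forall fun s => abs_le.1 (abs_signFun_le D A (s i)))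
    have h2 : ∫ s : Fin b → α, signFun D A (s i) ∂(Measure.pi fun _ : Fin b => p) =
        ∫ y, signFun D A y ∂p := by
      have h3 := (measurePreserving_eval (fun _ : Fin b => p) i)
      rw [← h3.map_eq, integral_map (measurable_pi_apply i).aemeasurable
        hm.aestronglyMeasurable, h3.map_eq]
    rw [h2] at h1
    convert h1 using 1
    norm_num
  have := HasSubgaussianMGF.measure_sum_ge_le_of_iIndepFun hindep (c := fun _ => 1)
    (s := Finset.univ.filter fun i : Fin b => (i : ℕ) < n) (fun i _ => hsub i) hr
  simpa [card_filter_fin_lt hnb] using this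

/-- Concentration of empirical frequencies (Bretagnolle–Huber–Carol): for the first `n` of `b`
samples, the total deviation over a finite set `D` exceeds `r` with exponentially small
probability. -/
theorem measure_sum_abs_empirical_sub_le [DecidableEq α] [Countable α] (p : Measure α) [IsProbabilityMeasure p] (D : Finset α)
    {n b : ℕ} (hn : 0 < n) (hnb : n ≤ b) {r : ℝ} (hr : 0 ≤ r) :
    (Measure.pi fun _ : Fin b => p).real
      {s | r ≤ ∑ z ∈ D, |((Finset.univ.filter fun i : Fin b => (i : ℕ) < n ∧ s i = z).card : ℝ) / n
        - p.real {z}|} ≤ 2 ^ D.card * Real.exp (-(n * r ^ 2 / 2)) := by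
  have hn' : (0 : ℝ) < n := by exact_mod_cast hn
  have hsub : {s : Fin b → α | r ≤ ∑ z ∈ D,
      |((Finset.univ.filter fun i : Fin b => (i : ℕ) < n ∧ s i = z).card : ℝ) / n - p.real {z}|} ⊆
      ⋃ A ∈ D.powerset, {s | n * r ≤ ∑ i ∈ Finset.univ.filter (fun i : Fin b => (i : ℕ) < n),
        (signFun D A (s i) - ∫ y, signFun D A y ∂p)} := by
    intro s hs
    simp only [Set.mem_ofPred_eq] at hs
    set cnt : α → ℝ := fun z =>
      ((Finset.univ.filter fun i : Fin b => (i : ℕ) < n ∧ s i = z).card : ℝ) with hcnt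
    -- For the set A of overestimated elements the signed sum equals the total deviation, so a union
    -- bound over the 2^|D| sign patterns suffices.
    set A := D.filter fun z => 0 ≤ cnt z / n - p.real {z} with hA
    refine Set.mem_biUnion (Finset.mem_powerset.2 (Finset.filter_subset _ D) : A ∈ D.powerset) ?_
    have h1 : ∑ i ∈ Finset.univ.filter (fun i : Fin b => (i : ℕ) < n), signFun D A (s i) =
        ∑ z ∈ D, (if z ∈ A then (1 : ℝ) else -1) * cnt z := by
      simp only [signFun]
      rw [Finset.sum_comm]
      refine Finset.sum_congr rfl fun z _ => ?_
      rw [← Finset.sum_filter, Finset.filter_filter, Finset.sum_const, nsmul_eq_mul, mul_comm]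
    have h2 : ∑ z ∈ D, |cnt z / n - p.real {z}| =
        ∑ z ∈ D, (if z ∈ A then (1 : ℝ) else -1) * (cnt z / n - p.real {z}) := by
      refine Finset.sum_congr rfl fun z hz => ?_
      by_cases h : 0 ≤ cnt z / n - p.real {z}
      · rw [if_pos (Finset.mem_filter.2 ⟨hz, h⟩), abs_of_nonneg h, one_mul]
      · have h' : z ∉ A := fun h' => h (Finset.mem_filter.1 h').2
        rw [if_neg h', abs_of_neg (not_le.1 h)]; ring
    simp only [Set.mem_ofPred_eq]
    rw [Finset.sum_sub_distrib, h1, Finset.sum_const, card_filter_fin_lt hnb, nsmul_eq_mul,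
      integral_signFun, Finset.mul_sum, ← Finset.sum_sub_distrib]
    calc n * r ≤ n * ∑ z ∈ D, |cnt z / n - p.real {z}| := by gcongr
      _ = _ := by
        rw [h2, Finset.mul_sum]
        refine Finset.sum_congr rfl fun z _ => ?_
        field_simp
  calc _ ≤ (Measure.pi fun _ : Fin b => p).real (⋃ A ∈ D.powerset,
        {s | n * r ≤ ∑ i ∈ Finset.univ.filter (fun i : Fin b => (i : ℕ) < n),
          (signFun D A (s i) - ∫ y, signFun D A y ∂p)}) := measureReal_mono hsub (measure_ne_top _ _)
    _ ≤ ∑ A ∈ D.powerset, (Measure.pi fun _ : Fin b => p).real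
        {s | n * r ≤ ∑ i ∈ Finset.univ.filter (fun i : Fin b => (i : ℕ) < n),
          (signFun D A (s i) - ∫ y, signFun D A y ∂p)} := measureReal_biUnion_finset_le _ _
    _ ≤ ∑ A ∈ D.powerset, Real.exp (-(n * r ^ 2 / 2)) := by
        refine Finset.sum_le_sum fun A _ => ?_
        refine (measure_signFun_sum_le p D A hnb (by positivity)).trans (le_of_eq ?_)
        congr 1
        field_simp
    _ = 2 ^ D.card * Real.exp (-(n * r ^ 2 / 2)) := by
        rw [Finset.sum_const, Finset.card_powerset, nsmul_eq_mul]; push_cast; rfl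

theorem card_mul_le_one_of_le_measureReal (p : Measure α) [IsProbabilityMeasure p] {τ : ℝ}
    {T : Finset α} (hT : ∀ z ∈ T, τ ≤ p.real {z}) : T.card * τ ≤ 1 := by
  calc T.card * τ = ∑ _z ∈ T, τ := by simp
    _ ≤ ∑ z ∈ T, p.real {z} := Finset.sum_le_sum hT
    _ = p.real T := by rw [sum_measureReal_singleton]
    _ ≤ 1 := measureReal_le_one

theorem finite_setOf_le_measureReal (p : Measure α) [IsProbabilityMeasure p] {τ : ℝ} (hτ : 0 < τ) :
    {z | τ ≤ p.real {z}}.Finite := by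
  by_contra hinf
  obtain ⟨T, hT, hc⟩ := Set.Infinite.exists_subset_card_eq hinf (⌊1 / τ⌋₊ + 1)
  have h1 := card_mul_le_one_of_le_measureReal p (τ := τ) (T := T) fun z hz => hT hz
  rw [hc, ← le_div_iff₀ hτ] at h1
  push_cast at h1
  linarith [Nat.lt_floor_add_one (1 / τ)]

/-- All elements of mass at least `τ` are observed, except with small probability. -/
theorem measure_exists_unobserved_le (p : Measure α) [IsProbabilityMeasure p] {τ : ℝ} (hτ : 0 < τ)
    (a : ℕ) : (Measure.pi fun _ : Fin a => p).real {s | ∃ z, τ ≤ p.real {z} ∧ ∀ i, s i ≠ z} ≤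
      Real.exp (-(a * τ)) / τ := by
  set Z := (finite_setOf_le_measureReal p hτ).toFinset with hZ
  have hmem : ∀ z, z ∈ Z ↔ τ ≤ p.real {z} := fun z => by simp [hZ]
  have hsub : {s : Fin a → α | ∃ z, τ ≤ p.real {z} ∧ ∀ i, s i ≠ z} ⊆
      ⋃ z ∈ Z, Set.univ.pi fun _ => {z}ᶜ := by
    rintro s ⟨z, hz, h⟩
    exact Set.mem_biUnion ((hmem z).2 hz) fun i _ => h i
  have hone : ∀ z ∈ Z, (Measure.pi fun _ : Fin a => p).real (Set.univ.pi fun _ => {z}ᶜ) ≤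
      Real.exp (-(a * τ)) := by
    intro z hz
    rw [measureReal_def, Measure.pi_pi, ENNReal.toReal_prod]
    simp only [Finset.prod_const, Finset.card_univ, Fintype.card_fin]
    have h1 : (p {z}ᶜ).toReal = 1 - p.real {z} := by
      rw [← measureReal_def, probReal_compl_eq_one_sub (measurableSet_singleton z)]
    rw [h1]
    have h2 : p.real {z} ≤ 1 := measureReal_le_one
    calc (1 - p.real {z}) ^ a ≤ Real.exp (-τ) ^ a := by
          refine pow_le_pow_left₀ (by linarith) ?_ a
          have h3 := Real.add_one_le_exp (-τ)
          have h4 := (hmem z).1 hz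
          linarith
      _ = Real.exp (-(a * τ)) := by rw [← Real.exp_nat_mul]; ring_nf
  calc _ ≤ (Measure.pi fun _ : Fin a => p).real (⋃ z ∈ Z, Set.univ.pi fun _ => {z}ᶜ) :=
        measureReal_mono hsub (measure_ne_top _ _)
    _ ≤ ∑ z ∈ Z, (Measure.pi fun _ : Fin a => p).real (Set.univ.pi fun _ => {z}ᶜ) :=
        measureReal_biUnion_finset_le _ _
    _ ≤ ∑ z ∈ Z, Real.exp (-(a * τ)) := Finset.sum_le_sum hone
    _ = Z.card * Real.exp (-(a * τ)) := by simp
    -- At most 1/τ elements can have mass τ or more.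
    _ ≤ Real.exp (-(a * τ)) / τ := by
        rw [le_div_iff₀ hτ]
        have := card_mul_le_one_of_le_measureReal p (τ := τ) (T := Z) fun z hz => (hmem z).1 hz
        nlinarith [Real.exp_pos (-(a * τ))]

/-- A set of pairs has small measure if all its slices do. -/
theorem measureReal_prod_le {X Y : Type*} [MeasurableSpace X] [MeasurableSpace Y] (μ : Measure X)
    [IsProbabilityMeasure μ] (ν : Measure Y) [IsProbabilityMeasure ν] {S : Set (X × Y)}
    (hS : MeasurableSet S) {c : ℝ} (hc : 0 ≤ c) (h : ∀ x, ν.real {y | (x, y) ∈ S} ≤ c) :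
    (μ.prod ν).real S ≤ c := by
  rw [measureReal_def, Measure.prod_apply hS]
  refine ENNReal.toReal_le_of_le_ofReal hc ?_
  calc ∫⁻ x, ν (Prod.mk x ⁻¹' S) ∂μ ≤ ∫⁻ _x, ENNReal.ofReal c ∂μ := by
        refine lintegral_mono fun x => ?_
        have := h x
        rw [measureReal_def] at this
        exact (ENNReal.le_ofReal_iff_toReal_le (measure_ne_top _ _) hc).2 this
    _ = ENNReal.ofReal c := by simp

/-- The probability of a set of samples indexed by a sum type is small if all its slices, for a
fixed first part, have small probability. -/
theorem pi_sum_real_le [Countable α] {ι κ : Type*} [Fintype ι] [Fintype κ] {S : Set (ι ⊕ κ → α)} {c : ℝ}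
    (p : Measure α) [IsProbabilityMeasure p] (hc : 0 ≤ c)
    (hS : ∀ x : ι → α, (Measure.pi fun _ : κ => p).real {y | Sum.elim x y ∈ S} ≤ c) :
    (Measure.pi fun _ : ι ⊕ κ => p).real S ≤ c := by
  have hmp := measurePreserving_sumPiEquivProdPi_symm (X := fun _ : ι ⊕ κ => α) fun _ => p
  have hSm : MeasurableSet S := MeasurableSet.of_discrete
  rw [measureReal_def, ← hmp.measure_preimage hSm.nullMeasurableSet, ← measureReal_def]
  refine measureReal_prod_le _ _ (hmp.measurable hSm) hc fun x => ?_
  refine le_trans (le_of_eq ?_) (hS x)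
  congr 1

end Concentration


/-! ### Correctness and replicability of heavy hitters -/

namespace HHParams

/-- The requirements on the input of the heavy hitters routine. -/
structure Valid (h : HHParams) : Prop where
  err_pos : 0 < h.err
  err_lt : h.err < h.v
  rho_pos : 0 < h.rho
  rho_le : h.rho ≤ 1
  delta_pos : 0 < h.delta
  delta_le : h.delta ≤ 1

/-- The deviation of the empirical masses that the routine tolerates. -/
def tol (h : HHParams) : ℝ := h.rho * h.err / 18

variable {h : HHParams} {α : Type*} [DecidableEq α] {dom : Finset α}

theorem Valid.tol_pos (hv : h.Valid) : 0 < h.tol :=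
  div_pos (mul_pos hv.rho_pos hv.err_pos) (by norm_num)

theorem card_candidates_le (s : h.SampleIdx dom.card → α) :
    (h.candidates dom s).card ≤ h.candBound dom.card := by
  unfold candidates candBound
  split_ifs with hc
  · exact le_rfl
  · refine Finset.card_image_le.trans ?_
    rw [Finset.card_univ, Fintype.card_fin, candSize, if_neg hc]

theorem estSize_mono {m n : ℕ} (hmn : m ≤ n) : h.estSize m ≤ h.estSize n := by
  unfold estSize
  refine Nat.ceil_mono (div_le_div_of_nonneg_right ?_ (by positivity))
  have h1 : (m : ℝ) ≤ n := by exact_mod_cast hmn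
  have h2 := Real.log_pos one_lt_two
  nlinarith

/-- Here 648 = 2 · 18²: the tolerance is ρη/18, so the exponent n tol²/2 is nρ²η²/648, which pays
for log(2/δ) and for the 2^m sign patterns. -/
theorem Valid.estSize_spec (hv : h.Valid) (m : ℕ) :
    0 < h.estSize m ∧
      2 ^ m * Real.exp (-(h.estSize m * h.tol ^ 2 / 2)) ≤ h.delta / 2 := by
  have hl := Real.log_pos one_lt_two
  have hl' : 0 ≤ Real.log (2 / h.delta) :=
    Real.log_nonneg (by rw [le_div_iff₀ hv.delta_pos]; linarith [hv.delta_le])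
  have hden : 0 < h.rho ^ 2 * h.err ^ 2 :=
    mul_pos (pow_pos hv.rho_pos 2) (pow_pos hv.err_pos 2)
  have hceil : (648 * Real.log (2 / h.delta) + 648 * ((m : ℝ) + 1) * Real.log 2) /
      (h.rho ^ 2 * h.err ^ 2) ≤ h.estSize m := Nat.le_ceil _
  constructor
  · refine Nat.ceil_pos.2 (div_pos ?_ hden)
    positivity
  · rw [div_le_iff₀ hden] at hceil
    have h1 : Real.log (2 / h.delta) + m * Real.log 2 ≤ h.estSize m * h.tol ^ 2 / 2 := by
      unfold tol
      nlinarith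
    calc 2 ^ m * Real.exp (-(h.estSize m * h.tol ^ 2 / 2))
        ≤ 2 ^ m * Real.exp (-(Real.log (2 / h.delta) + m * Real.log 2)) := by gcongr
      _ = h.delta / 2 := by
        rw [neg_add, Real.exp_add, Real.exp_neg, Real.exp_log (div_pos two_pos hv.delta_pos),
          ← mul_neg, Real.exp_nat_mul, Real.exp_neg, Real.exp_log two_pos]
        have : (2 : ℝ) ^ m ≠ 0 := by positivity
        field_simp
        rw [mul_right_comm, ← mul_pow]
        norm_num

variable [MeasurableSpace α]

/-- The samples are representative of the distribution `p`. -/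
structure Good (h : HHParams) (dom : Finset α) (p : Measure α)
    (s : h.SampleIdx dom.card → α) : Prop where
  mem_candidates : ∀ z, h.v - h.err ≤ p.real {z} → z ∈ h.candidates dom s
  sum_abs_lt : ∑ z ∈ h.candidates dom s, |h.empirical dom s z - p.real {z}| < h.tol

variable {p : Measure α} {s s' : h.SampleIdx dom.card → α}

theorem Good.abs_lt (hg : h.Good dom p s) {z : α} (hz : z ∈ h.candidates dom s) :
    |h.empirical dom s z - p.real {z}| < h.tol :=
  (Finset.single_le_sum (f := fun z => |h.empirical dom s z - p.real {z}|)
    (fun _ _ => abs_nonneg _) hz).trans_lt hg.sum_abs_lt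

/-- The random threshold keeps a margin of a third of the error from both v and v - err, which
exceeds the tolerance. So neither values of mass at least v nor, in the next lemma, those of mass
below v - err depend on the seed. -/
theorem Good.mem_rHeavyHitters (hv : h.Valid) (hg : h.Good dom p s) (u : unitInterval) {z : α}
    (hz : h.v ≤ p.real {z}) : z ∈ h.rHeavyHitters dom s u := by
  have hc := hg.mem_candidates z (by linarith [hv.err_pos])
  refine Finset.mem_filter.2 ⟨hc, ?_⟩
  have h1 := _root_.abs_lt.1 (hg.abs_lt hc)
  have h2 : h.tol ≤ h.err / 3 := by
    unfold tol; nlinarith [hv.err_pos, hv.rho_le]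
  have h3 : (u : ℝ) * (h.err / 3) ≤ 1 * (h.err / 3) := by
    have := hv.err_pos
    gcongr; exact u.2.2
  linarith

theorem Good.le_of_mem_rHeavyHitters (hv : h.Valid) (hg : h.Good dom p s) {u : unitInterval}
    {z : α} (hc : z ∈ h.candidates dom s)
    (hz : h.v - 2 / 3 * h.err + (u : ℝ) * (h.err / 3) ≤ h.empirical dom s z) :
    h.v - h.err ≤ p.real {z} := by
  have h1 := _root_.abs_lt.1 (hg.abs_lt hc)
  have h2 : h.tol ≤ h.err / 18 := by
    unfold tol; nlinarith [hv.err_pos, hv.rho_le]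
  have h3 : 0 ≤ (u : ℝ) * (h.err / 3) := mul_nonneg u.2.1 (by linarith [hv.err_pos])
  linarith [hv.err_pos]

/-- If the outputs for two good samples differ, then the random threshold separates the empirical
masses of a common candidate. -/
theorem Good.exists_separated (hv : h.Valid) (hg : h.Good dom p s) (hg' : h.Good dom p s')
    {u : unitInterval} (hne : h.rHeavyHitters dom s u ≠ h.rHeavyHitters dom s' u) :
    ∃ z ∈ h.candidates dom s ∩ h.candidates dom s',
      h.v - 2 / 3 * h.err + (u : ℝ) * (h.err / 3) ∈
        Set.uIoc (h.empirical dom s z) (h.empirical dom s' z) := by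
  by_contra hcon
  simp only [not_exists, not_and] at hcon
  refine hne (Finset.ext fun z => ?_)
  -- Masses of at least v - err are candidates in both runs; smaller ones are returned in neither.
  by_cases hc : h.v - h.err ≤ p.real {z}
  · have h1 := hg.mem_candidates z hc
    have h2 := hg'.mem_candidates z hc
    have h3 := hcon z (Finset.mem_inter.2 ⟨h1, h2⟩)
    simp only [rHeavyHitters, Finset.mem_filter, h1, h2, true_and]
    rw [Set.mem_uIoc] at h3
    push Not at h3
    constructor
    · intro h4
      by_contra h5
      exact absurd (h3.2 (not_le.1 h5)) (not_lt.2 h4)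
    · intro h4
      by_contra h5
      exact absurd (h3.1 (not_le.1 h5)) (not_lt.2 h4)
  · simp only [rHeavyHitters, Finset.mem_filter]
    constructor
    · rintro ⟨h1, h2⟩
      exact absurd (hg.le_of_mem_rHeavyHitters hv h1 h2) hc
    · rintro ⟨h1, h2⟩
      exact absurd (hg'.le_of_mem_rHeavyHitters hv h1 h2) hc

theorem volume_setOf_affine_mem_uIoc_le {c e a b : ℝ} (he : 0 < e) :
    (volume : Measure unitInterval).real {u | c + (u : ℝ) * e ∈ Set.uIoc a b} ≤ |a - b| / e := by
  have hsub : (Subtype.val '' {u : unitInterval | c + (u : ℝ) * e ∈ Set.uIoc a b}) ⊆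
      Set.Ioc ((min a b - c) / e) ((max a b - c) / e) := by
    rintro _ ⟨u, hu, rfl⟩
    have hu' : min a b < c + u * e ∧ c + u * e ≤ max a b := hu
    rw [Set.mem_Ioc, div_lt_iff₀ he, le_div_iff₀ he]
    constructor <;> linarith
  rw [measureReal_def, unitInterval.volume_apply]
  refine ENNReal.toReal_le_of_le_ofReal (by positivity) ((measure_mono hsub).trans ?_)
  rw [Real.volume_Ioc]
  refine ENNReal.ofReal_le_ofReal (le_of_eq ?_)
  rw [← sub_div, ← max_sub_min_eq_abs]
  rw [max_comm b a, min_comm b a]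
  ring

/-- A threshold uniform on an interval of length err/3 falls into a gap g with probability at most
3g/err. The gaps sum to at most 2 tol, since goodness controls the total deviation, so no factor for
the number of candidates is lost. This fixes the 18 in `tol`: 2 (ρ err/18)/(err/3) = ρ/3. -/
theorem Good.volume_ne_le (hv : h.Valid) (hg : h.Good dom p s) (hg' : h.Good dom p s') :
    (volume : Measure unitInterval).real
      {u | h.rHeavyHitters dom s u ≠ h.rHeavyHitters dom s' u} ≤ h.rho / 3 := by
  have he : 0 < h.err / 3 := by linarith [hv.err_pos]
  set T := h.candidates dom s ∩ h.candidates dom s'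
  have hsub : {u | h.rHeavyHitters dom s u ≠ h.rHeavyHitters dom s' u} ⊆
      ⋃ z ∈ T, {u : unitInterval | h.v - 2 / 3 * h.err + (u : ℝ) * (h.err / 3) ∈
        Set.uIoc (h.empirical dom s z) (h.empirical dom s' z)} := by
    intro u hu
    obtain ⟨z, hz, hz'⟩ := hg.exists_separated hv hg' hu
    exact Set.mem_biUnion (by exact hz) hz'
  have h1 : ∑ z ∈ T, |h.empirical dom s z - p.real {z}| ≤ h.tol :=
    (Finset.sum_le_sum_of_subset_of_nonneg Finset.inter_subset_left
      fun _ _ _ => abs_nonneg _).trans hg.sum_abs_lt.le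
  have h2 : ∑ z ∈ T, |h.empirical dom s' z - p.real {z}| ≤ h.tol :=
    (Finset.sum_le_sum_of_subset_of_nonneg Finset.inter_subset_right
      fun _ _ _ => abs_nonneg _).trans hg'.sum_abs_lt.le
  calc _ ≤ (volume : Measure unitInterval).real (⋃ z ∈ T, {u : unitInterval |
          h.v - 2 / 3 * h.err + (u : ℝ) * (h.err / 3) ∈
            Set.uIoc (h.empirical dom s z) (h.empirical dom s' z)}) :=
        measureReal_mono hsub (measure_ne_top _ _)
    _ ≤ ∑ z ∈ T, _ := measureReal_biUnion_finset_le _ _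
    _ ≤ ∑ z ∈ T, |h.empirical dom s z - h.empirical dom s' z| / (h.err / 3) :=
        Finset.sum_le_sum fun z _ => volume_setOf_affine_mem_uIoc_le he
    _ ≤ (2 * h.tol) / (h.err / 3) := by
        rw [← Finset.sum_div]
        gcongr
        calc _ ≤ ∑ z ∈ T, (|h.empirical dom s z - p.real {z}| +
              |h.empirical dom s' z - p.real {z}|) := by
              refine Finset.sum_le_sum fun z _ => ?_
              have := abs_sub_le (h.empirical dom s z) (p.real {z}) (h.empirical dom s' z)
              rwa [abs_sub_comm (p.real {z})] at this
          _ ≤ 2 * h.tol := by rw [Finset.sum_add_distrib]; linarith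
    _ = h.rho / 3 := by
        have := hv.err_pos
        unfold tol
        field_simp
        ring

variable [Countable α] [MeasurableSingletonClass α] [IsProbabilityMeasure p]

/-- With τ = v - err, `threshold` is the number a of samples that makes the bound exp(-aτ)/τ equal
to δ/2. If the whole domain is taken instead, only elements of mass zero can be missed. -/
theorem Valid.measure_not_mem_candidates_le (hv : h.Valid) (hdom : ∀ z, z ∉ dom → p.real {z} = 0) :
    (Measure.pi fun _ : h.SampleIdx dom.card => p).real
      {s | ∃ z, h.v - h.err ≤ p.real {z} ∧ z ∉ h.candidates dom s} ≤ h.delta / 2 := by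
  have hτ : 0 < h.v - h.err := sub_pos.2 hv.err_lt
  by_cases hc : (dom.card : ℝ) < h.threshold
  · have : {s : h.SampleIdx dom.card → α |
        ∃ z, h.v - h.err ≤ p.real {z} ∧ z ∉ h.candidates dom s} = ∅ := by
      ext s
      simp only [Set.mem_ofPred_eq, Set.mem_empty_iff_false, iff_false, not_exists, not_and, not_not]
      intro z hz
      rw [candidates, if_pos hc]
      by_contra hz'
      rw [hdom z hz'] at hz
      linarith
    rw [this, measureReal_empty]
    linarith [hv.delta_pos]
  · have h1 : (Measure.pi fun _ : h.SampleIdx dom.card => p).real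
        {s | ∃ z, h.v - h.err ≤ p.real {z} ∧ z ∉ h.candidates dom s} ≤
        (Measure.pi fun _ : Fin (h.candSize dom.card) => p).real
          {s | ∃ z, h.v - h.err ≤ p.real {z} ∧ ∀ i, s i ≠ z} := by
      have hmp := measurePreserving_sumPiEquivProdPi
        (X := fun _ : h.SampleIdx dom.card => α) fun _ => p
      have hfst := (measurePreserving_fst (μ := Measure.pi fun _ : Fin (h.candSize dom.card) => p)
        (ν := Measure.pi fun _ : Fin (h.estSize (h.candBound dom.card)) => p)).comp hmp
      rw [measureReal_def, measureReal_def, ← hfst.measure_preimage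
        (MeasurableSet.of_discrete).nullMeasurableSet]
      refine ENNReal.toReal_mono (measure_ne_top _ _) (measure_mono ?_)
      rintro s ⟨z, hz, hz'⟩
      refine ⟨z, hz, fun i hi => hz' ?_⟩
      rw [candidates, if_neg hc]
      exact Finset.mem_image.2 ⟨i, Finset.mem_univ _, hi⟩
    refine h1.trans ((measure_exists_unobserved_le p hτ _).trans ?_)
    rw [div_le_iff₀ hτ]
    have h2 : h.threshold ≤ h.candSize dom.card := by
      rw [candSize, if_neg hc]; exact Nat.le_ceil _
    rw [threshold, div_le_iff₀ hτ] at h2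
    calc Real.exp (-(h.candSize dom.card * (h.v - h.err)))
        ≤ Real.exp (-Real.log (2 / (h.delta * (h.v - h.err)))) := by gcongr
      _ = h.delta / 2 * (h.v - h.err) := by
        have := hv.delta_pos
        rw [Real.exp_neg, Real.exp_log (by positivity)]
        field_simp

/-- Conditioning on the first phase fixes the candidates, and with them the number of estimation
samples. The second phase is independent of it, so concentration applies to a fixed set and a fixed
sample size. -/
theorem Valid.measure_tol_le (hv : h.Valid) :
    (Measure.pi fun _ : h.SampleIdx dom.card => p).real
      {s | h.tol ≤ ∑ z ∈ h.candidates dom s, |h.empirical dom s z - p.real {z}|} ≤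
        h.delta / 2 := by
  refine pi_sum_real_le p (by linarith [hv.delta_pos]) fun x => ?_
  set D : Finset α := if (dom.card : ℝ) < h.threshold then dom else Finset.univ.image x with hD
  have hcand : ∀ y, h.candidates dom (Sum.elim x y : h.SampleIdx dom.card → α) = D := by
    intro y
    simp only [candidates, Sum.elim_inl, hD]
  obtain ⟨hpos, hle⟩ := hv.estSize_spec D.card
  -- The bound on the number of candidates speaks of a full sample, so some second block is needed;
  -- if none exists, the slice is empty.
  by_cases hne : Nonempty (Fin (h.estSize (h.candBound dom.card)) → α)
  · obtain ⟨y₀⟩ := hne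
    have hb : h.estSize D.card ≤ h.estSize (h.candBound dom.card) := by
      rw [← hcand y₀]
      exact estSize_mono (card_candidates_le _)
    refine le_trans (le_of_eq ?_)
      ((measure_sum_abs_empirical_sub_le p D hpos hb hv.tol_pos.le).trans hle)
    congr 1
  · have : {y | Sum.elim x y ∈ {s : h.SampleIdx dom.card → α |
        h.tol ≤ ∑ z ∈ h.candidates dom s, |h.empirical dom s z - p.real {z}|}} = ∅ := by
      ext y; exact absurd ⟨y⟩ hne
    rw [this, measureReal_empty]
    linarith [hv.delta_pos]

theorem Valid.measure_not_good_le (hv : h.Valid) (hdom : ∀ z, z ∉ dom → p.real {z} = 0) :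
    (Measure.pi fun _ : h.SampleIdx dom.card => p).real {s | ¬ h.Good dom p s} ≤ h.delta := by
  have hsub : {s | ¬ h.Good dom p s} ⊆
      {s | ∃ z, h.v - h.err ≤ p.real {z} ∧ z ∉ h.candidates dom s} ∪
      {s | h.tol ≤ ∑ z ∈ h.candidates dom s, |h.empirical dom s z - p.real {z}|} := by
    intro s hs
    by_contra hcon
    simp only [Set.mem_union, Set.mem_ofPred_eq, not_or, not_exists, not_and, not_not,
      not_le] at hcon
    exact hs ⟨hcon.1, hcon.2⟩
  calc _ ≤ _ := measureReal_mono hsub (measure_ne_top _ _)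
    _ ≤ _ := measureReal_union_le _ _
    _ ≤ h.delta / 2 + h.delta / 2 :=
        add_le_add (hv.measure_not_mem_candidates_le hdom) hv.measure_tol_le
    _ = h.delta := by ring

/-- Two runs of heavy hitters with a shared seed rarely differ. -/
theorem Valid.measure_rHeavyHitters_ne_le (hv : h.Valid) (hdom : ∀ z, z ∉ dom → p.real {z} = 0) :
    (((Measure.pi fun _ : h.SampleIdx dom.card => p).prod
      (Measure.pi fun _ : h.SampleIdx dom.card => p)).prod (volume : Measure unitInterval)).real
      {z | h.rHeavyHitters dom z.1.1 z.2 ≠ h.rHeavyHitters dom z.1.2 z.2} ≤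
      2 * h.delta + h.rho / 3 := by
  set μ := Measure.pi fun _ : h.SampleIdx dom.card => p with hμ
  set B : Set (h.SampleIdx dom.card → α) := {s | ¬ h.Good dom p s}
  have hB : μ.real B ≤ h.delta := hv.measure_not_good_le hdom
  -- Restricting to good pairs makes the bound on the seed hold for every slice, not just for
  -- typical ones.
  set G : Set (((h.SampleIdx dom.card → α) × (h.SampleIdx dom.card → α)) × unitInterval) :=
    {z | (h.Good dom p z.1.1 ∧ h.Good dom p z.1.2) ∧
      h.rHeavyHitters dom z.1.1 z.2 ≠ h.rHeavyHitters dom z.1.2 z.2} with hG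
  have hmeas : ∀ s : h.SampleIdx dom.card → α, ∀ a : α,
      MeasurableSet {u : unitInterval | a ∈ h.rHeavyHitters dom s u} := by
    intro s a
    simp only [rHeavyHitters, Finset.mem_filter]
    change MeasurableSet ({_u | a ∈ h.candidates dom s} ∩ {u : unitInterval |
      h.v - 2 / 3 * h.err + (u : ℝ) * (h.err / 3) ≤ h.empirical dom s a})
    refine (MeasurableSet.const _).inter (measurableSet_le ?_ measurable_const)
    exact (measurable_subtype_coe.mul_const _).const_add _
  -- There are only countably many pairs of samples, so G is a countable union of slabs.
  have hGm : MeasurableSet G := by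
    have : G = ⋃ x : (h.SampleIdx dom.card → α) × (h.SampleIdx dom.card → α),
        {x} ×ˢ {u | (h.Good dom p x.1 ∧ h.Good dom p x.2) ∧
          ∃ a, ¬ (a ∈ h.rHeavyHitters dom x.1 u ↔ a ∈ h.rHeavyHitters dom x.2 u)} := by
      ext ⟨x, u⟩
      simp [hG, Finset.ext_iff]
    rw [this]
    refine MeasurableSet.iUnion fun x => (measurableSet_singleton x).prod ?_
    have : {u | (h.Good dom p x.1 ∧ h.Good dom p x.2) ∧
          ∃ a, ¬ (a ∈ h.rHeavyHitters dom x.1 u ↔ a ∈ h.rHeavyHitters dom x.2 u)} =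
        {_u | h.Good dom p x.1 ∧ h.Good dom p x.2} ∩
          ⋃ a, {u | a ∈ h.rHeavyHitters dom x.1 u ↔ a ∈ h.rHeavyHitters dom x.2 u}ᶜ := by
      ext u
      simp
    rw [this]
    exact (MeasurableSet.const _).inter
      (MeasurableSet.iUnion fun a => ((hmeas x.1 a).iff (hmeas x.2 a)).compl)
  have hGle : ((μ.prod μ).prod (volume : Measure unitInterval)).real G ≤ h.rho / 3 := by
    refine measureReal_prod_le _ _ hGm (by linarith [hv.rho_pos]) fun x => ?_
    by_cases hx : h.Good dom p x.1 ∧ h.Good dom p x.2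
    · simpa [hG, hx] using hx.1.volume_ne_le hv hx.2
    · simpa [hG, hx] using (by linarith [hv.rho_pos] : (0 : ℝ) ≤ h.rho / 3)
  have hsub : {z : ((h.SampleIdx dom.card → α) × (h.SampleIdx dom.card → α)) × unitInterval |
      h.rHeavyHitters dom z.1.1 z.2 ≠ h.rHeavyHitters dom z.1.2 z.2} ⊆
      ((B ×ˢ Set.univ) ×ˢ Set.univ) ∪ ((Set.univ ×ˢ B) ×ˢ Set.univ) ∪ G := by
    intro z hz
    by_cases h1 : h.Good dom p z.1.1
    · by_cases h2 : h.Good dom p z.1.2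
      · exact Or.inr ⟨⟨h1, h2⟩, hz⟩
      · exact Or.inl (Or.inr ⟨⟨trivial, h2⟩, trivial⟩)
    · exact Or.inl (Or.inl ⟨⟨h1, trivial⟩, trivial⟩)
  calc _ ≤ _ := measureReal_mono hsub (measure_ne_top _ _)
    _ ≤ _ := (measureReal_union_le _ _).trans (add_le_add_left (measureReal_union_le _ _) _)
    _ ≤ h.delta + h.delta + h.rho / 3 := by
        refine add_le_add (add_le_add ?_ ?_) hGle <;>
        simpa [measureReal_prod_prod] using hB
    _ = _ := by ring

end HHParams


/-! ### Replicability of the coreset algorithm and correctness of its heavy hitters calls -/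

section Marginals

variable {X Y ι κ : Type*} [MeasurableSpace X] [MeasurableSpace Y] [Fintype ι] [Fintype κ]

/-- Used to isolate the block of one layer: its discretized samples are again i.i.d., with the law
of the cell index. -/
theorem measurePreserving_pi_comp (P : Measure X) [IsProbabilityMeasure P] {f : X → Y}
    (hf : Measurable f) {e : κ → ι} (he : Function.Injective e) :
    MeasurePreserving (fun (s : ι → X) (j : κ) => f (s (e j))) (Measure.pi fun _ => P)
      (Measure.pi fun _ => P.map f) := by
  classical
  have : IsProbabilityMeasure (P.map f) := Measure.isProbabilityMeasure_map hf.aemeasurable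
  have hm : Measurable fun (s : ι → X) (j : κ) => f (s (e j)) :=
    measurable_pi_iff.2 fun j => hf.comp (measurable_pi_apply _)
  refine ⟨hm, (Measure.pi_eq fun t ht => ?_).symm⟩
  rw [Measure.map_apply hm (MeasurableSet.univ_pi ht)]
  -- The preimage of a box is a box whose sides outside the range of e are the whole space, hence
  -- have measure one.
  have hpre : (fun (s : ι → X) (j : κ) => f (s (e j))) ⁻¹' Set.univ.pi t =
      Set.univ.pi (Function.extend e (fun j => f ⁻¹' t j) fun _ => Set.univ) := by
    ext s
    simp only [Set.mem_preimage, Set.mem_univ_pi]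
    constructor
    · intro h i
      by_cases hi : ∃ j, e j = i
      · obtain ⟨j, rfl⟩ := hi
        rw [he.extend_apply]
        exact h j
      · rw [Function.extend_apply' _ _ _ hi]
        trivial
    · intro h j
      have := h (e j)
      rwa [he.extend_apply] at this
  rw [hpre, Measure.pi_pi]
  rw [← Finset.prod_subset (Finset.subset_univ (Finset.univ.image e)), Finset.prod_image]
  · refine Finset.prod_congr rfl fun j _ => ?_
    rw [he.extend_apply, Measure.map_apply hf (ht j)]
  · exact fun _ _ _ _ h => he h
  · intro i _ hi
    rw [Function.extend_apply', measure_univ]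
    rintro ⟨j, rfl⟩
    exact hi (Finset.mem_image_of_mem _ (Finset.mem_univ j))

/-- Only an inequality, but valid for arbitrary sets, so the bad events need no measurability proof.
-/
theorem MeasurePreserving.real_preimage_le {μ : Measure X} {ν : Measure Y} [IsFiniteMeasure ν]
    {f : X → Y} (hf : MeasurePreserving f μ ν) (S : Set Y) : μ.real (f ⁻¹' S) ≤ ν.real S := by
  refine ENNReal.toReal_mono (measure_ne_top _ _) ?_
  rw [← hf.map_eq]
  exact Measure.le_map_apply hf.measurable.aemeasurable S

/-- Subadditivity alone gives this, so S may be nonmeasurable. -/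
theorem one_sub_le_measureReal {μ : Measure X} [IsProbabilityMeasure μ] {S : Set X} {c : ℝ}
    (h : μ.real Sᶜ ≤ c) : 1 - c ≤ μ.real S := by
  have h1 := measureReal_union_le (μ := μ) S Sᶜ
  rw [Set.union_compl_self, probReal_univ] at h1
  linarith

end Marginals

namespace Params

variable {d : ℕ} (q : Params d)

/-- The discretized samples of layer `l + 1`. -/
def layerSample (s : q.SampleIdx → (Fin d → ℝ)) (l : Fin (q.numLayers - 1)) :
    (q.hh (l + 1)).SampleIdx (grid d (l + 1)).card → (Fin d → ℕ) :=
  fun j => cellIndex (l + 1) (s ⟨l, j⟩)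

theorem layerHitters_eq (s : q.SampleIdx → (Fin d → ℝ)) (r : q.Seed)
    (l : Fin (q.numLayers - 1)) : q.layerHitters s r l =
      (q.hh (l + 1)).rHeavyHitters (grid d (l + 1)) (q.layerSample s l) (r l) := by
  rw [layerHitters, dif_pos l.2]
  rfl

theorem measurePreserving_layerSample (P : Measure (Fin d → ℝ)) [IsProbabilityMeasure P]
    (l : Fin (q.numLayers - 1)) :
    MeasurePreserving (fun s => q.layerSample s l) (Measure.pi fun _ : q.SampleIdx => P)
      (Measure.pi fun _ => P.map (cellIndex (l + 1))) :=
  measurePreserving_pi_comp P (measurable_cellIndex _)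
    (e := fun j => (⟨l, j⟩ : q.SampleIdx)) fun _ _ h => by simpa using h

theorem map_cellIndex_real (P : Measure (Fin d → ℝ)) (i : ℕ) (z : Fin d → ℕ) :
    (P.map (cellIndex i)).real {z} = P.real (cellIndex i ⁻¹' {z}) :=
  map_measureReal_apply (measurable_cellIndex i) (measurableSet_singleton z)

theorem map_cellIndex_real_of_notMem (P : Measure (Fin d → ℝ)) {i : ℕ} {z : Fin d → ℕ}
    (hz : z ∉ grid d i) : (P.map (cellIndex i)).real {z} = 0 := by
  rw [map_cellIndex_real]
  have : (cellIndex i ⁻¹' {z} : Set (Fin d → ℝ)) = ∅ := by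
    ext x
    simp only [Set.mem_preimage, Set.mem_singleton_iff, Set.mem_empty_iff_false, iff_false]
    rintro rfl
    exact hz (cellIndex_mem_grid i x)
  rw [this, measureReal_empty]

theorem sum_layers_le {a : ℝ} (ha : 0 ≤ a) :
    ∑ _l : Fin (q.numLayers - 1), a / q.numLayers ≤ a := by
  rw [Finset.sum_const, Finset.card_univ, Fintype.card_fin, nsmul_eq_mul]
  rcases Nat.eq_zero_or_pos q.numLayers with h | h
  · simp [h, ha]
  · have h1 : ((q.numLayers - 1 : ℕ) : ℝ) ≤ q.numLayers := by exact_mod_cast Nat.sub_le _ _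
    have h2 : (0 : ℝ) < q.numLayers := by exact_mod_cast h
    rw [mul_div_assoc', div_le_iff₀ h2]
    nlinarith

variable {q}

theorem heavy_congr {s s' : q.SampleIdx → (Fin d → ℝ)} {r : q.Seed}
    (h : ∀ l, q.layerHitters s r l = q.layerHitters s' r l) (i : ℕ) :
    q.heavy s r i = q.heavy s' r i := by
  induction i with
  | zero => simp only [heavy]
  | succ i ih => simp only [heavy, ih, h]

/-- Samples influence the output only through the heavy hitters of the layers, so two runs with
different outputs must disagree in some call. A call disagrees with probability at most (2δ + ρ/3)/t
≤ ρ/t. -/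
theorem isReplicable_rCoreset (c : ChoiceRule q.N) (D : Set (Fin d → ℝ))
    (hv : ∀ l : Fin (q.numLayers - 1), (q.hh (l + 1)).Valid) (hrho : 0 ≤ q.rho)
    (hdelta : 3 * q.delta ≤ q.rho) : IsReplicable D q.rho (q.rCoreset c) := by
  intro P hP _
  refine one_sub_le_measureReal ?_
  set μ := Measure.pi fun _ : q.SampleIdx => P
  set B : Fin (q.numLayers - 1) →
      Set (((q.SampleIdx → (Fin d → ℝ)) × (q.SampleIdx → (Fin d → ℝ))) × q.Seed) :=
    fun l => {z | q.layerHitters z.1.1 z.2 l ≠ q.layerHitters z.1.2 z.2 l} with hB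
  have hsub : {z : ((q.SampleIdx → (Fin d → ℝ)) × (q.SampleIdx → (Fin d → ℝ))) × q.Seed |
      q.rCoreset c z.1.1 z.2 = q.rCoreset c z.1.2 z.2}ᶜ ⊆ ⋃ l, B l := by
    intro z hz
    by_contra hcon
    refine hz ?_
    have h1 : ∀ l, q.layerHitters z.1.1 z.2 l = q.layerHitters z.1.2 z.2 l := by
      intro l
      by_cases hl : l < q.numLayers - 1
      · by_contra hne
        exact hcon (Set.mem_iUnion.2 ⟨⟨l, hl⟩, hne⟩)
      · rw [layerHitters, layerHitters, dif_neg hl, dif_neg hl]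
    have h2 : q.heavy z.1.1 z.2 = q.heavy z.1.2 z.2 := funext (heavy_congr h1)
    change q.rCoreset c z.1.1 z.2 = q.rCoreset c z.1.2 z.2
    funext x
    unfold rCoreset
    rw [h2]
  have hone : ∀ l, ((μ.prod μ).prod (volume : Measure q.Seed)).real (B l) ≤
      q.rho / q.numLayers := by
    intro l
    have hp : IsProbabilityMeasure (P.map (cellIndex (l + 1 : ℕ))) :=
      Measure.isProbabilityMeasure_map (measurable_cellIndex _).aemeasurable
    have hmp := q.measurePreserving_layerSample P l
    have hmp3 := (hmp.prod hmp).prod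
      (measurePreserving_eval (fun _ : Fin (q.numLayers - 1) => (volume : Measure unitInterval)) l)
    refine (MeasurePreserving.real_preimage_le hmp3 {z | (q.hh (l + 1)).rHeavyHitters
      (grid d (l + 1)) z.1.1 z.2 ≠ (q.hh (l + 1)).rHeavyHitters (grid d (l + 1)) z.1.2 z.2}
      |>.trans' (measureReal_mono ?_ (measure_ne_top _ _))).trans
      (((hv l).measure_rHeavyHitters_ne_le fun z => map_cellIndex_real_of_notMem P).trans ?_)
    · intro z hz
      have hz' : q.layerHitters z.1.1 z.2 l ≠ q.layerHitters z.1.2 z.2 l := hz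
      rw [layerHitters_eq, layerHitters_eq] at hz'
      exact hz'
    · change 2 * (q.delta / q.numLayers) + q.rho / q.numLayers / 3 ≤ _
      have : 2 * (q.delta / q.numLayers) + q.rho / q.numLayers / 3 =
        (2 * q.delta + q.rho / 3) / q.numLayers := by ring
      rw [this]
      gcongr
      linarith
  calc _ ≤ ((μ.prod μ).prod (volume : Measure q.Seed)).real (⋃ l, B l) :=
        measureReal_mono hsub (measure_ne_top _ _)
    _ ≤ ∑ l, ((μ.prod μ).prod (volume : Measure q.Seed)).real (B l) :=
        measureReal_iUnion_fintype_le _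
    _ ≤ ∑ l : Fin (q.numLayers - 1), q.rho / q.numLayers := Finset.sum_le_sum fun l _ => hone l
    _ ≤ q.rho := q.sum_layers_le hrho

/-- With probability at least `1 - δ`, the samples of all layers are representative. -/
theorem one_sub_le_measure_good {P : Measure (Fin d → ℝ)} [IsProbabilityMeasure P]
    (hv : ∀ l : Fin (q.numLayers - 1), (q.hh (l + 1)).Valid) (hdelta : 0 ≤ q.delta)
    {S : Set ((q.SampleIdx → (Fin d → ℝ)) × q.Seed)}
    (hS : ∀ z, (∀ l : Fin (q.numLayers - 1), (q.hh (l + 1)).Good (grid d (l + 1))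
      (P.map (cellIndex (l + 1))) (q.layerSample z.1 l)) → z ∈ S) :
    1 - q.delta ≤
      ((Measure.pi fun _ : q.SampleIdx => P).prod (volume : Measure q.Seed)).real S := by
  refine one_sub_le_measureReal ?_
  set μ := Measure.pi fun _ : q.SampleIdx => P
  set B : Fin (q.numLayers - 1) → Set (q.SampleIdx → (Fin d → ℝ)) := fun l =>
    (fun s => q.layerSample s l) ⁻¹' {s | ¬ (q.hh (l + 1)).Good (grid d (l + 1))
      (P.map (cellIndex (l + 1))) s} with hB
  have hsub : Sᶜ ⊆ ⋃ l, (B l) ×ˢ (Set.univ : Set q.Seed) := by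
    intro z hz
    by_contra hcon
    refine hz (hS z fun l => ?_)
    by_contra hl
    exact hcon (Set.mem_iUnion.2 ⟨l, hl, trivial⟩)
  have hone : ∀ l, (μ.prod (volume : Measure q.Seed)).real (B l ×ˢ Set.univ) ≤
      q.delta / q.numLayers := by
    intro l
    have hp : IsProbabilityMeasure (P.map (cellIndex (l + 1 : ℕ))) :=
      Measure.isProbabilityMeasure_map (measurable_cellIndex _).aemeasurable
    rw [measureReal_prod_prod, probReal_univ, mul_one]
    exact (MeasurePreserving.real_preimage_le (q.measurePreserving_layerSample P l) _).trans
      ((hv l).measure_not_good_le fun z => map_cellIndex_real_of_notMem P)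
  calc _ ≤ (μ.prod (volume : Measure q.Seed)).real (⋃ l, (B l) ×ˢ (Set.univ : Set q.Seed)) :=
        measureReal_mono hsub (measure_ne_top _ _)
    _ ≤ ∑ l, (μ.prod (volume : Measure q.Seed)).real (B l ×ˢ Set.univ) :=
        measureReal_iUnion_fintype_le _
    _ ≤ ∑ l : Fin (q.numLayers - 1), q.delta / q.numLayers := Finset.sum_le_sum fun l _ => hone l
    _ ≤ q.delta := q.sum_layers_le hdelta

end Params


/-! ### The tree of heavy cells and the map to representatives -/

namespace Params

variable {d : ℕ} (q : Params d)

/-- `H` is a tree of heavy cells for `P`, as obtained from representative samples. -/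
structure IsHeavyTree (P : Measure (Fin d → ℝ)) (H : ℕ → Finset (Fin d → ℕ)) : Prop where
  zero : H 0 = {fun _ => 0}
  eq_empty : ∀ j, q.numLayers ≤ j → H j = ∅
  exists_parent : ∀ i, ∀ b ∈ H (i + 1), ∃ a ∈ H i, b ∈ children i a
  le_mass : ∀ i, ∀ b ∈ H (i + 1), (q.hh (i + 1)).v / 2 ≤ P.real (cellIndex (i + 1) ⁻¹' {b})
  mass_lt : ∀ i, i + 1 < q.numLayers →
    ¬ (cubeDiam q.N / 2 ^ i) ^ q.p ≤ q.eps * q.lam / 5 →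
    ∀ a ∈ H i, ∀ b ∈ children i a, b ∉ H (i + 1) →
    P.real (cellIndex (i + 1) ⁻¹' {b}) < (q.hh (i + 1)).v

variable {q}

theorem isHeavyTree_heavy {P : Measure (Fin d → ℝ)} {s : q.SampleIdx → (Fin d → ℝ)} {r : q.Seed}
    (hv : ∀ l : Fin (q.numLayers - 1), (q.hh (l + 1)).Valid) (ht : 0 < q.numLayers)
    (hgood : ∀ l : Fin (q.numLayers - 1), (q.hh (l + 1)).Good (grid d (l + 1))
      (P.map (cellIndex (l + 1))) (q.layerSample s l)) : q.IsHeavyTree P (q.heavy s r) where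
  zero := rfl
  eq_empty j hj := by
    cases j with
    | zero => omega
    | succ i =>
      -- Call l serves layer l + 1, so the last call is for layer t - 1 and deeper layers have no
      -- hitters.
      have : ¬ i < q.numLayers - 1 := by omega
      simp [heavy, layerHitters, this]
  exists_parent i b hb := by
    simp only [heavy] at hb
    split_ifs at hb
    · simp at hb
    · simpa using (Finset.mem_inter.1 hb).1
  le_mass i b hb := by
    simp only [heavy] at hb
    split_ifs at hb
    · simp at hb
    · have hb' := (Finset.mem_inter.1 hb).2
      by_cases hi : i < q.numLayers - 1
      · have h1 := q.layerHitters_eq s r ⟨i, hi⟩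
        simp only at h1
        rw [h1] at hb'
        obtain ⟨h2, h3⟩ := Finset.mem_filter.1 hb'
        have h4 := (hgood ⟨i, hi⟩).le_of_mem_rHeavyHitters (hv ⟨i, hi⟩) h2 h3
        rw [map_cellIndex_real] at h4
        -- The error is v/2, so v - err = v/2.
        refine le_trans (le_of_eq ?_) h4
        simp only [hh]
        ring
      · simp [layerHitters, hi] at hb'
  mass_lt i hi hlarge a ha b hb hb' := by
    by_contra hcon
    have hi' : i < q.numLayers - 1 := by omega
    refine hb' ?_
    rw [heavy, if_neg hlarge, Finset.mem_inter]
    refine ⟨Finset.mem_biUnion.2 ⟨a, ha, hb⟩, ?_⟩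
    have h1 := q.layerHitters_eq s r ⟨i, hi'⟩
    simp only at h1
    rw [h1]
    refine (hgood ⟨i, hi'⟩).mem_rHeavyHitters (hv ⟨i, hi'⟩) _ ?_
    rw [map_cellIndex_real]
    exact not_lt.1 hcon

namespace IsHeavyTree

variable {P : Measure (Fin d → ℝ)} {H : ℕ → Finset (Fin d → ℕ)}

theorem numLayers_pos (hH : q.IsHeavyTree P H) : 0 < q.numLayers := by
  by_contra h
  have h1 := hH.eq_empty 0 (by omega)
  rw [hH.zero] at h1
  simp at h1

theorem lt_numLayers (hH : q.IsHeavyTree P H) {j : ℕ} {b : Fin d → ℕ} (hb : b ∈ H j) :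
    j < q.numLayers := by
  by_contra h
  rw [hH.eq_empty j (by omega)] at hb
  simp at hb

theorem mem_grid (hH : q.IsHeavyTree P H) {j : ℕ} {b : Fin d → ℕ} (hb : b ∈ H j) :
    b ∈ grid d j := by
  cases j with
  | zero =>
    rw [hH.zero, Finset.mem_singleton] at hb
    rw [hb]
    exact cellIndex_zero (0 : Fin d → ℝ) ▸ cellIndex_mem_grid 0 _
  | succ i =>
    obtain ⟨a, -, h⟩ := hH.exists_parent i b hb
    exact (mem_children_iff.1 h).1

theorem cellIndex_mem_of_succ (hH : q.IsHeavyTree P H) {i : ℕ} {x : Fin d → ℝ}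
    (hx : cellIndex (i + 1) x ∈ H (i + 1)) : cellIndex i x ∈ H i := by
  obtain ⟨a, ha, h⟩ := hH.exists_parent i _ hx
  rw [← cellIndex_succ_div, (mem_children_iff.1 h).2]
  exact ha

theorem cellIndex_mem_of_le (hH : q.IsHeavyTree P H) {i j : ℕ} (hij : i ≤ j) {x : Fin d → ℝ}
    (hx : cellIndex j x ∈ H j) : cellIndex i x ∈ H i := by
  induction j, hij using Nat.le_induction with
  | base => exact hx
  | succ j _ ih => exact ih (hH.cellIndex_mem_of_succ hx)

/-- The representative of a heavy cell is the chosen point of a heavy descendant without heavy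
children. -/
theorem exists_leaf (hH : q.IsHeavyTree P H) (c : ChoiceRule q.N) (n : ℕ) :
    ∀ {i : ℕ} {a : Fin d → ℕ}, a ∈ H i → q.numLayers ≤ i + n →
    ∃ j, ∃ b ∈ H j, children j b ∩ H (j + 1) = ∅ ∧
      q.representative c H n i a = c.point j b ∧
      ∀ x : Fin d → ℝ, cellIndex j x = b → cellIndex i x = a := by
  induction n with
  | zero =>
    intro i a ha hi
    -- The recursion cannot run out of steps at a heavy cell, since no layer from t on has any.
    rw [hH.eq_empty i (by omega)] at ha
    simp at ha
  | succ n ih =>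
    intro i a ha hi
    by_cases h : children i a ∩ H (i + 1) = ∅
    · exact ⟨i, a, ha, h, by rw [representative, if_pos h], fun x hx => hx⟩
    · have hp := c.pick_mem (i + 1) _ (Finset.nonempty_iff_ne_empty.2 h)
      obtain ⟨hp1, hp2⟩ := Finset.mem_inter.1 hp
      obtain ⟨j, b, hb, hl, hr, hx⟩ := ih hp2 (by omega)
      refine ⟨j, b, hb, hl, by rw [representative, if_neg h, hr], fun x hxb => ?_⟩
      rw [← cellIndex_succ_div, hx x hxb]
      exact (mem_children_iff.1 hp1).2

end IsHeavyTree

variable (q) in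
/-- The level of the smallest heavy cell that contains `x`. -/
def level (H : ℕ → Finset (Fin d → ℕ)) (x : Fin d → ℝ) : ℕ :=
  Nat.findGreatest (fun j => cellIndex j x ∈ H j) q.numLayers

variable (q) in
/-- The map of points to representatives that belongs to a tree of heavy cells. -/
def toRep (c : ChoiceRule q.N) (H : ℕ → Finset (Fin d → ℕ)) (x : Fin d → ℝ) : Fin d → ℝ :=
  q.representative c H q.numLayers (q.level H x) (cellIndex (q.level H x) x)

theorem measurable_level (H : ℕ → Finset (Fin d → ℕ)) : Measurable (q.level H) := by
  refine measurable_findGreatest fun k _ => ?_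
  exact measurable_cellIndex k (Finset.measurableSet (H k))

/-- A point enters only through its level and a cell index, both countably valued, so the choice
rule can be arbitrary. -/
theorem measurable_toRep (c : ChoiceRule q.N) (H : ℕ → Finset (Fin d → ℕ)) :
    Measurable (q.toRep c H) := by
  have h1 : Measurable fun z : ℕ × (Fin d → ℝ) =>
      q.representative c H q.numLayers z.1 (cellIndex z.1 z.2) := by
    refine measurable_from_prod_countable_right fun i => ?_
    exact (measurable_of_countable fun a => q.representative c H q.numLayers i a).comp
      (measurable_cellIndex i)
  exact h1.comp ((measurable_level H).prodMk measurable_id)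

namespace IsHeavyTree

variable {P : Measure (Fin d → ℝ)} {H : ℕ → Finset (Fin d → ℕ)}

theorem cellIndex_level_mem (hH : q.IsHeavyTree P H) (x : Fin d → ℝ) :
    cellIndex (q.level H x) x ∈ H (q.level H x) :=
  Nat.findGreatest_spec (P := fun j => cellIndex j x ∈ H j) (Nat.zero_le q.numLayers)
    (by rw [hH.zero, cellIndex_zero]; exact Finset.mem_singleton_self _)

/-- Heavy cells live strictly above layer t, so the next level is still inside the search range of
`Nat.findGreatest`. -/
theorem cellIndex_level_succ_notMem (hH : q.IsHeavyTree P H) (x : Fin d → ℝ) :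
    cellIndex (q.level H x + 1) x ∉ H (q.level H x + 1) :=
  Nat.findGreatest_is_greatest (P := fun j => cellIndex j x ∈ H j) (Nat.lt_succ_self _)
    (hH.lt_numLayers (hH.cellIndex_level_mem x))

/-- The leaf that supplies the representative descends from the smallest heavy cell of x, so x and
its image share that cell; this bounds the movement. -/
theorem exists_toRep_eq_point (hH : q.IsHeavyTree P H) (c : ChoiceRule q.N) (x : Fin d → ℝ) :
    ∃ j, ∃ b ∈ H j, children j b ∩ H (j + 1) = ∅ ∧ q.toRep c H x = c.point j b ∧
      cellIndex (q.level H x) (q.toRep c H x) = cellIndex (q.level H x) x := by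
  obtain ⟨j, b, hb, hl, hr, hx⟩ := hH.exists_leaf c q.numLayers (hH.cellIndex_level_mem x)
    (Nat.le_add_left _ _)
  refine ⟨j, b, hb, hl, hr, hx _ ?_⟩
  rw [toRep, hr]
  exact (c.point_mem_cell j b (hH.mem_grid hb)).2

theorem toRep_mem_cube (hH : q.IsHeavyTree P H) (c : ChoiceRule q.N) (x : Fin d → ℝ) (i : Fin d) :
    q.toRep c H x i ∈ Set.Icc (-(1 / 2) : ℝ) (1 / 2) := by
  obtain ⟨j, b, hb, -, hr, -⟩ := hH.exists_toRep_eq_point c x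
  rw [hr]
  exact (c.point_mem_cell j b (hH.mem_grid hb)).1 i

theorem map_sub_toRep_le (hH : q.IsHeavyTree P H) (hN : IsAdmissibleNorm q.N) (c : ChoiceRule q.N)
    {x : Fin d → ℝ} (hx : x ∈ unitDiamBall q.N) :
    q.N (x - q.toRep c H x) ≤ cubeDiam q.N / 2 ^ q.level H x := by
  obtain ⟨j, b, hb, -, hr, he⟩ := hH.exists_toRep_eq_point c x
  exact map_sub_le_of_cellIndex_eq hN (mem_cube_of_mem_unitDiamBall hN hx)
    (hH.toRep_mem_cube c x) he.symm

/-- A heavy cell below the root has positive mass, and P lives on the ball; the root contains the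
origin. Hence the choice rule picks points of the ball. -/
theorem cell_inter_ball_nonempty (hH : q.IsHeavyTree P H) (hN : IsAdmissibleNorm q.N)
    (hP : ∀ᵐ x ∂P, x ∈ unitDiamBall q.N) (hγ : 0 < q.gamma) (hlam : 0 < q.lam) {j : ℕ}
    {b : Fin d → ℕ} (hb : b ∈ H j) : (cell j b ∩ unitDiamBall q.N).Nonempty := by
  cases j with
  | zero =>
    rw [hH.zero, Finset.mem_singleton] at hb
    have h0 : (0 : Fin d → ℝ) ∈ unitDiamBall q.N := by
      change q.N 0 ≤ 1 / 2
      rw [map_zero]; norm_num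
    exact ⟨0, ⟨mem_cube_of_mem_unitDiamBall hN h0, by rw [hb, cellIndex_zero]⟩, h0⟩
  | succ i =>
    have h1 := hH.le_mass i b hb
    have h2 : 0 < P.real (cellIndex (i + 1) ⁻¹' {b}) := by
      refine lt_of_lt_of_le ?_ h1
      simp only [hh]
      positivity
    by_contra hne
    have h3 : (cellIndex (i + 1) ⁻¹' {b} : Set (Fin d → ℝ)) ⊆ (unitDiamBall q.N)ᶜ := by
      intro x hx hxB
      exact hne ⟨x, ⟨mem_cube_of_mem_unitDiamBall hN hxB, hx⟩, hxB⟩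
    have h4 : P (cellIndex (i + 1) ⁻¹' {b}) = 0 := measure_mono_null h3 hP
    rw [measureReal_def, h4] at h2
    simp at h2

theorem toRep_mem_ball (hH : q.IsHeavyTree P H) (hN : IsAdmissibleNorm q.N)
    (hP : ∀ᵐ x ∂P, x ∈ unitDiamBall q.N) (hγ : 0 < q.gamma) (hlam : 0 < q.lam)
    (c : ChoiceRule q.N) (x : Fin d → ℝ) : q.toRep c H x ∈ unitDiamBall q.N := by
  obtain ⟨j, b, hb, -, hr, -⟩ := hH.exists_toRep_eq_point c x
  rw [hr]
  exact c.point_mem_ball j b (hH.cell_inter_ball_nonempty hN hP hγ hlam hb)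

/-! ### The number of representatives -/

/-- The heavy cells without heavy children. -/
def _root_.ReplicableCoreset.leaves (t : ℕ) (H : ℕ → Finset (Fin d → ℕ)) :
    Finset (Σ _ : ℕ, Fin d → ℕ) :=
  (Finset.range t).sigma fun j => (H j).filter fun b => children j b ∩ H (j + 1) = ∅

theorem mem_leaves (hH : q.IsHeavyTree P H) {j : ℕ} {b : Fin d → ℕ} :
    (⟨j, b⟩ : Σ _ : ℕ, Fin d → ℕ) ∈ leaves q.numLayers H ↔
      b ∈ H j ∧ children j b ∩ H (j + 1) = ∅ := by
  simp only [leaves, Finset.mem_sigma, Finset.mem_range, Finset.mem_filter, and_iff_right_iff_imp]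
  exact fun h => hH.lt_numLayers h.1

/-- Leaves are disjoint: if a deeper one shared a point with a shallower one, its heavy ancestors
would give the latter a heavy child. -/
theorem leaves_unique (hH : q.IsHeavyTree P H) {e e' : Σ _ : ℕ, Fin d → ℕ}
    (he : e ∈ leaves q.numLayers H) (he' : e' ∈ leaves q.numLayers H) {x : Fin d → ℝ}
    (hx : cellIndex e.1 x = e.2) (hx' : cellIndex e'.1 x = e'.2) : e = e' := by
  have aux : ∀ {e e' : Σ _ : ℕ, Fin d → ℕ}, e ∈ leaves q.numLayers H →
      e' ∈ leaves q.numLayers H → cellIndex e.1 x = e.2 → cellIndex e'.1 x = e'.2 →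
      ¬ e.1 < e'.1 := by
    rintro ⟨j, b⟩ ⟨j', b'⟩ h h' hx hx' hlt
    rw [hH.mem_leaves] at h h'
    simp only at hx hx' hlt
    have h1 : cellIndex (j + 1) x ∈ H (j + 1) :=
      hH.cellIndex_mem_of_le hlt (by rw [hx']; exact h'.1)
    have h2 : cellIndex (j + 1) x ∈ children j b := hx ▸ cellIndex_succ_mem_children j x
    have h3 := Finset.mem_inter.2 ⟨h2, h1⟩
    rw [h.2] at h3
    simp at h3
  have h1 := aux he he' hx hx'
  have h2 := aux he' he hx' hx
  obtain ⟨j, b⟩ := e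
  obtain ⟨j', b'⟩ := e'
  simp only at hx hx' h1 h2
  obtain rfl : j = j' := by omega
  rw [← hx, ← hx']

theorem image_toRep_subset (hH : q.IsHeavyTree P H) (c : ChoiceRule q.N) (S : Set (Fin d → ℝ)) :
    q.toRep c H '' S ⊆ ((fun e : Σ _ : ℕ, Fin d → ℕ => c.point e.1 e.2) ''
      (leaves q.numLayers H : Set (Σ _ : ℕ, Fin d → ℕ))) := by
  rintro _ ⟨x, -, rfl⟩
  obtain ⟨j, b, hb, hl, hr, -⟩ := hH.exists_toRep_eq_point c x
  exact ⟨⟨j, b⟩, hH.mem_leaves.2 ⟨hb, hl⟩, hr.symm⟩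

theorem finite_image_toRep (hH : q.IsHeavyTree P H) (c : ChoiceRule q.N) (S : Set (Fin d → ℝ)) :
    (q.toRep c H '' S).Finite :=
  ((Finset.finite_toSet _).image _).subset (hH.image_toRep_subset c S)

theorem ncard_image_toRep_le (hH : q.IsHeavyTree P H) (c : ChoiceRule q.N)
    (S : Set (Fin d → ℝ)) : (q.toRep c H '' S).ncard ≤ (leaves q.numLayers H).card := by
  refine (Set.ncard_le_ncard (hH.image_toRep_subset c S)
    ((Finset.finite_toSet _).image _)).trans ?_
  refine (Set.ncard_image_le (Finset.finite_toSet _)).trans ?_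
  rw [Set.ncard_coe_finset]

theorem integrable_distTo_sq [IsProbabilityMeasure P] {N : Seminorm ℝ (Fin d → ℝ)}
    (hN : IsAdmissibleNorm N) (hP : ∀ᵐ x ∂P, x ∈ unitDiamBall N) {F : Finset (Fin d → ℝ)}
    (hF : F.Nonempty) (hFB : (F : Set (Fin d → ℝ)) ⊆ unitDiamBall N) :
    Integrable (fun x => distTo N x F ^ 2) P := by
  refine Integrable.of_bound ((measurable_distTo hN F).pow_const 2).aestronglyMeasurable 1 ?_
  filter_upwards [hP] with x hx
  rw [Real.norm_of_nonneg (sq_nonneg _)]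
  exact pow_le_one₀ (distTo_nonneg x) (distTo_le_one hF hFB hx)

theorem integrable_indicator_cell [IsProbabilityMeasure P] (i : ℕ) (b : Fin d → ℕ) (a : ℝ) :
    Integrable ((cellIndex i ⁻¹' {b}).indicator fun _ => a) P :=
  (integrable_const a).indicator (measurable_cellIndex i (measurableSet_singleton b))

theorem integral_indicator_cell [IsProbabilityMeasure P] (i : ℕ) (b : Fin d → ℕ) (a : ℝ) :
    ∫ x, (cellIndex i ⁻¹' {b}).indicator (fun _ => a) x ∂P =
      P.real (cellIndex i ⁻¹' {b}) * a := by
  rw [integral_indicator_const _ (measurable_cellIndex i (measurableSet_singleton b)), smul_eq_mul]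

/-- The leaves near to a set of centers are few because of the geometry, and those far away are
few because each of them contributes to the cost. -/
theorem card_leaves_le (hH : q.IsHeavyTree P H) [IsProbabilityMeasure P] (hp : q.p = 2)
    (hN : IsAdmissibleNorm q.N)
    (hP : ∀ᵐ x ∂P, x ∈ unitDiamBall q.N) (hγ : 0 < q.gamma) (hlam : 0 < q.lam)
    (hΔ : 0 < cubeDiam q.N) {F : Finset (Fin d → ℝ)} (hF : F.Nonempty)
    (hFB : (F : Set (Fin d → ℝ)) ⊆ unitDiamBall q.N) :
    ((leaves q.numLayers H).card : ℝ) ≤ q.numLayers * (F.card * (2 * cubeDiam q.N + 3) ^ d) +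
      2 * cost q.N 2 P F / (q.gamma * q.lam * cubeDiam q.N ^ 2) := by
  classical
  set Δ := cubeDiam q.N
  set L := leaves q.numLayers H
  -- With the radius equal to the cell diameter bound, the packing bound does not depend on the
  -- level.
  set near : (Σ _ : ℕ, Fin d → ℕ) → Prop := fun e => e.2 ∈ nearCells q.N F e.1 (Δ / 2 ^ e.1)
  have hnear : ((L.filter near).card : ℝ) ≤ q.numLayers * (F.card * (2 * Δ + 3) ^ d) := by
    have hsub : L.filter near ⊆
        (Finset.range q.numLayers).sigma fun j => nearCells q.N F j (Δ / 2 ^ j) := by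
      rintro ⟨j, b⟩ he
      obtain ⟨h1, h2⟩ := Finset.mem_filter.1 he
      exact Finset.mem_sigma.2 ⟨(Finset.mem_sigma.1 h1).1, h2⟩
    calc ((L.filter near).card : ℝ) ≤
          (((Finset.range q.numLayers).sigma fun j => nearCells q.N F j (Δ / 2 ^ j)).card : ℝ) := by
          exact_mod_cast Finset.card_le_card hsub
      _ = ∑ j ∈ Finset.range q.numLayers, ((nearCells q.N F j (Δ / 2 ^ j)).card : ℝ) := by
          rw [Finset.card_sigma]; push_cast; rfl
      _ ≤ ∑ _j ∈ Finset.range q.numLayers, F.card * (2 * Δ + 3) ^ d := by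
          refine Finset.sum_le_sum fun j _ => ?_
          refine (card_nearCells_le hN F j (by positivity)).trans (le_of_eq ?_)
          congr 3
          field_simp
      _ = _ := by simp
  set Far := L.filter fun e => ¬ near e with hFar
  -- By disjointness at most one summand is nonzero, and a far leaf has no point within Δ/2^j of F.
  have hpt : ∀ x ∈ unitDiamBall q.N, ∑ e ∈ Far, (cellIndex e.1 ⁻¹' {e.2}).indicator
      (fun _ => (Δ / 2 ^ e.1) ^ 2) x ≤ distTo q.N x F ^ 2 := by
    intro x hx
    by_cases hex : ∃ e ∈ Far, cellIndex e.1 x = e.2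
    · obtain ⟨e, he, hxe⟩ := hex
      rw [Finset.sum_eq_single e]
      · rw [Set.indicator_of_mem (by exact hxe)]
        have h1 : Δ / 2 ^ e.1 ≤ distTo q.N x F := by
          by_contra hlt
          refine (Finset.mem_filter.1 he).2 ?_
          obtain ⟨f, hf, hfx⟩ := exists_distTo_eq (N := q.N) hF x
          refine Finset.mem_filter.2 ⟨hxe ▸ cellIndex_mem_grid _ _, x,
            mem_cube_of_mem_unitDiamBall hN hx, hxe, f, hf, ?_⟩
          rw [← hfx]
          exact (not_le.1 hlt).le
        gcongr
      · intro e' he' hne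
        refine Set.indicator_of_notMem (fun h => hne ?_) _
        exact hH.leaves_unique (Finset.mem_filter.1 he').1 (Finset.mem_filter.1 he).1 h hxe
      · exact fun h => absurd he h
    · refine le_trans (Finset.sum_nonpos fun e he => ?_) (sq_nonneg _)
      have hne : x ∉ cellIndex e.1 ⁻¹' {e.2} := fun h => hex ⟨e, he, h⟩
      rw [Set.indicator_of_notMem hne]
  have hmass : ∀ e ∈ Far, q.gamma * q.lam * Δ ^ 2 / 2 ≤
      P.real (cellIndex e.1 ⁻¹' {e.2}) * (Δ / 2 ^ e.1) ^ 2 := by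
    rintro ⟨j, b⟩ he
    obtain ⟨h1, h2⟩ := Finset.mem_filter.1 he
    obtain ⟨hb, -⟩ := hH.mem_leaves.1 h1
    cases j with
    -- `le_mass` says nothing about the root, but the root contains a center and so is never far.
    | zero =>
      refine absurd ?_ h2
      obtain ⟨f, hf⟩ := hF
      refine Finset.mem_filter.2 ⟨hH.mem_grid hb, f, mem_cube_of_mem_unitDiamBall hN (hFB hf), ?_,
        f, hf, ?_⟩
      · rw [hH.zero, Finset.mem_singleton] at hb
        simp only [hb, cellIndex_zero]
      · rw [sub_self, map_zero]; positivity
    | succ i =>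
      have h3 := hH.le_mass i b hb
      simp only [hh, hp] at h3
      calc q.gamma * q.lam * Δ ^ 2 / 2
          = q.gamma * q.lam * 2 ^ (2 * (i + 1)) / 2 * (Δ / 2 ^ (i + 1)) ^ 2 := by
            rw [pow_mul']
            field_simp
        _ ≤ _ := by gcongr
  have hint : Far.card * (q.gamma * q.lam * Δ ^ 2 / 2) ≤ cost q.N 2 P F := by
    calc Far.card * (q.gamma * q.lam * Δ ^ 2 / 2)
        = ∑ e ∈ Far, q.gamma * q.lam * Δ ^ 2 / 2 := by simp
      _ ≤ ∑ e ∈ Far, P.real (cellIndex e.1 ⁻¹' {e.2}) * (Δ / 2 ^ e.1) ^ 2 :=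
          Finset.sum_le_sum hmass
      _ = ∫ x, ∑ e ∈ Far, (cellIndex e.1 ⁻¹' {e.2}).indicator
            (fun _ => (Δ / 2 ^ e.1) ^ 2) x ∂P := by
          rw [integral_finsetSum _ fun e _ => integrable_indicator_cell _ _ _]
          simp_rw [integral_indicator_cell]
      _ ≤ cost q.N 2 P F := by
          refine integral_mono_ae
            (integrable_finsetSum _ fun e _ => integrable_indicator_cell _ _ _)
            (integrable_distTo_sq hN hP hF hFB) ?_
          filter_upwards [hP] with x hx using hpt x hx
  have hsplit : (L.card : ℝ) = (L.filter near).card + Far.card := by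
    rw [hFar]
    exact_mod_cast (Finset.card_filter_add_card_filter_not near).symm
  rw [hsplit]
  refine add_le_add hnear ?_
  rw [le_div_iff₀ (by positivity)]
  linarith

end IsHeavyTree

end Params


/-! ### Movement of the mass and the coreset property -/

namespace Params

variable {d : ℕ} {q : Params d}

/-- The last layer consists of small cells. -/
theorem div_pow_le_of_numLayers_le (hp : q.p = 2) (heps : 0 < q.eps) (hlam : 0 < q.lam)
    (hΔ : 0 < cubeDiam q.N) {i : ℕ} (hi : q.numLayers ≤ i + 1) :
    (cubeDiam q.N / 2 ^ i) ^ q.p ≤ q.eps * q.lam / 5 := by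
  have h1 : 1 / (q.p : ℝ) * Real.logb 2 (5 * cubeDiam q.N ^ q.p / (q.eps * q.lam)) + 1 ≤
      ((i + 1 : ℕ) : ℝ) := (Nat.le_ceil _).trans (by exact_mod_cast hi)
  rw [hp] at h1 ⊢
  push_cast at h1
  have h2 : Real.logb 2 (5 * cubeDiam q.N ^ 2 / (q.eps * q.lam)) ≤ (2 * i : ℕ) := by
    push_cast; linarith
  have hpos : 0 < 5 * cubeDiam q.N ^ 2 / (q.eps * q.lam) := by positivity
  rw [Real.logb_le_iff_le_rpow one_lt_two hpos, Real.rpow_natCast, div_le_iff₀ (by positivity)] at h2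
  rw [div_pow, ← pow_mul, mul_comm i 2, div_le_iff₀ (by positivity)]
  linarith

namespace IsHeavyTree

variable {P : Measure (Fin d → ℝ)} {H : ℕ → Finset (Fin d → ℕ)}

open Classical in
variable (q) in
/-- The cells of level `l + 1` that have small mass and are near to `F`. -/
def _root_.ReplicableCoreset.Params.lightNear (P : Measure (Fin d → ℝ)) (F : Finset (Fin d → ℝ))
    (l : ℕ) : Finset (Fin d → ℕ) :=
  (nearCells q.N F (l + 1) (cubeDiam q.N / 2 ^ l * (4 / q.eps))).filter fun b =>
    P.real (cellIndex (l + 1) ⁻¹' {b}) < (q.hh (l + 1)).v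

/-- One summand for each case: tiny cell, center far away compared to the cell, light child near F.
The indicators sum over all light near cells so that integration turns them into masses. -/
theorem sq_map_sub_toRep_le (hH : q.IsHeavyTree P H) (hp : q.p = 2) (hN : IsAdmissibleNorm q.N)
    (c : ChoiceRule q.N) (heps : 0 < q.eps) (heps1 : q.eps ≤ 1 / 2) (hlam : 0 < q.lam)
    (hΔ : 0 < cubeDiam q.N) {F : Finset (Fin d → ℝ)} (hF : F.Nonempty) {x : Fin d → ℝ}
    (hx : x ∈ unitDiamBall q.N) :
    q.N (x - q.toRep c H x) ^ 2 ≤ q.eps * q.lam / 5 + q.eps / 5 * distTo q.N x F ^ 2 +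
      ∑ l ∈ Finset.range (q.numLayers - 1), ∑ b ∈ q.lightNear P F l,
        (cellIndex (l + 1) ⁻¹' {b}).indicator (fun _ => (cubeDiam q.N / 2 ^ l) ^ 2) x := by
  set i := q.level H x with hi
  have hmove := hH.map_sub_toRep_le hN c hx
  rw [← hi] at hmove
  have hsq : q.N (x - q.toRep c H x) ^ 2 ≤ (cubeDiam q.N / 2 ^ i) ^ 2 :=
    pow_le_pow_left₀ (apply_nonneg _ _) hmove 2
  have hD : 0 ≤ q.eps / 5 * distTo q.N x F ^ 2 := by positivity
  have hS : ∀ l b, 0 ≤ (cellIndex (l + 1) ⁻¹' {b}).indicator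
      (fun _ => (cubeDiam q.N / 2 ^ l) ^ 2) x :=
    fun l b => Set.indicator_nonneg (fun _ _ => by positivity) _
  have hS' : 0 ≤ ∑ l ∈ Finset.range (q.numLayers - 1), ∑ b ∈ q.lightNear P F l,
        (cellIndex (l + 1) ⁻¹' {b}).indicator (fun _ => (cubeDiam q.N / 2 ^ l) ^ 2) x :=
    Finset.sum_nonneg fun l _ => Finset.sum_nonneg fun b _ => hS l b
  have hL : 0 ≤ q.eps * q.lam / 5 := by positivity
  by_cases hlarge : (cubeDiam q.N / 2 ^ i) ^ q.p ≤ q.eps * q.lam / 5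
  · rw [hp] at hlarge
    linarith
  · have hit : i + 1 < q.numLayers := by
      by_contra hcon
      exact hlarge (div_pow_le_of_numLayers_le hp heps hlam hΔ (not_lt.1 hcon))
    have hlight := hH.mass_lt i hit hlarge _ (hH.cellIndex_level_mem x) _
      (cellIndex_succ_mem_children i x) (hH.cellIndex_level_succ_notMem x)
    by_cases hnear : distTo q.N x F ≤ cubeDiam q.N / 2 ^ i * (4 / q.eps)
    · have hmem : cellIndex (i + 1) x ∈ q.lightNear P F i := by
        classical
        obtain ⟨f, hf, hfx⟩ := exists_distTo_eq (N := q.N) hF x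
        refine Finset.mem_filter.2 ⟨Finset.mem_filter.2 ⟨cellIndex_mem_grid _ _, x,
          mem_cube_of_mem_unitDiamBall hN hx, rfl, f, hf, ?_⟩, hlight⟩
        rw [← hfx]; exact hnear
      have h1 : (cubeDiam q.N / 2 ^ i) ^ 2 ≤ ∑ b ∈ q.lightNear P F i,
          (cellIndex (i + 1) ⁻¹' {b}).indicator (fun _ => (cubeDiam q.N / 2 ^ i) ^ 2) x := by
        refine le_trans (le_of_eq ?_) (Finset.single_le_sum (fun b _ => hS i b) hmem)
        rw [Set.indicator_of_mem (by exact rfl)]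
      have h2 := Finset.single_le_sum (f := fun l => ∑ b ∈ q.lightNear P F l,
        (cellIndex (l + 1) ⁻¹' {b}).indicator (fun _ => (cubeDiam q.N / 2 ^ l) ^ 2) x)
        (fun l _ => Finset.sum_nonneg fun b _ => hS l b)
        (Finset.mem_range.2 (show i < q.numLayers - 1 by omega))
      linarith
    · have h1 : cubeDiam q.N / 2 ^ i ≤ q.eps / 4 * distTo q.N x F := by
        have h3 := (not_le.1 hnear).le
        rw [mul_div_assoc', div_le_iff₀ heps] at h3
        linarith
      have h2 : (cubeDiam q.N / 2 ^ i) ^ 2 ≤ (q.eps / 4 * distTo q.N x F) ^ 2 :=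
        pow_le_pow_left₀ (by positivity) h1 2
      have h3 : (q.eps / 4 * distTo q.N x F) ^ 2 ≤ q.eps / 5 * distTo q.N x F ^ 2 := by
        rw [mul_pow]
        gcongr
        nlinarith
      linarith

theorem integrable_sq_map_sub_toRep (hH : q.IsHeavyTree P H) [IsProbabilityMeasure P]
    (hN : IsAdmissibleNorm q.N) (hP : ∀ᵐ x ∂P, x ∈ unitDiamBall q.N) (hγ : 0 < q.gamma)
    (hlam : 0 < q.lam) (c : ChoiceRule q.N) :
    Integrable (fun x => q.N (x - q.toRep c H x) ^ 2) P := by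
  refine Integrable.of_bound ((hN.continuous.measurable.comp
    (measurable_id.sub (measurable_toRep c H))).pow_const 2).aestronglyMeasurable 1 ?_
  filter_upwards [hP] with x hx
  rw [Real.norm_of_nonneg (sq_nonneg _)]
  exact pow_le_one₀ (apply_nonneg _ _)
    (map_sub_le_one hx (hH.toRep_mem_ball hN hP hγ hlam c x))

/-- A light near cell contributes at most γΛ4^(l+1) (Δ/2^l)² = γΛ(2Δ)² on every layer; there are at
most kM of them on each of fewer than t layers, and γ was defined to make the product ε'Λ/5. -/
theorem sum_lightNear_le (hH : q.IsHeavyTree P H) [IsProbabilityMeasure P] (hp : q.p = 2)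
    (hN : IsAdmissibleNorm q.N) (hk : 0 < q.k) (heps : 0 < q.eps) (heps1 : q.eps ≤ 1 / 2)
    (hlam : 0 < q.lam) (hΔ : 1 ≤ cubeDiam q.N) {F : Finset (Fin d → ℝ)} (hFk : F.card = q.k) :
    ∑ l ∈ Finset.range (q.numLayers - 1), ∑ b ∈ q.lightNear P F l,
      P.real (cellIndex (l + 1) ⁻¹' {b}) * (cubeDiam q.N / 2 ^ l) ^ 2 ≤ q.eps * q.lam / 5 := by
  classical
  have ht : (0 : ℝ) < q.numLayers := by exact_mod_cast hH.numLayers_pos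
  have hk' : (0 : ℝ) < q.k := by exact_mod_cast hk
  have hΔ0 : 0 < cubeDiam q.N := by linarith
  have hγ : 0 < q.gamma := by unfold gamma; positivity
  have hone : ∀ l, ∑ b ∈ q.lightNear P F l, P.real (cellIndex (l + 1) ⁻¹' {b}) *
      (cubeDiam q.N / 2 ^ l) ^ 2 ≤
      q.k * (2 ^ 5 * cubeDiam q.N / q.eps) ^ d * (q.gamma * q.lam * (2 * cubeDiam q.N) ^ 2) := by
    intro l
    have h1 : ∀ b ∈ q.lightNear P F l, P.real (cellIndex (l + 1) ⁻¹' {b}) *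
        (cubeDiam q.N / 2 ^ l) ^ 2 ≤ q.gamma * q.lam * (2 * cubeDiam q.N) ^ 2 := by
      intro b hb
      have h2 := (Finset.mem_filter.1 hb).2.le
      simp only [hh, hp] at h2
      calc _ ≤ q.gamma * q.lam * 2 ^ (2 * (l + 1)) * (cubeDiam q.N / 2 ^ l) ^ 2 := by gcongr
        _ = _ := by
          rw [pow_mul', mul_pow 2]
          field_simp
          ring
    refine (Finset.sum_le_sum h1).trans ?_
    rw [Finset.sum_const, nsmul_eq_mul]
    have h2 : ((q.lightNear P F l).card : ℝ) ≤
        q.k * (2 ^ 5 * cubeDiam q.N / q.eps) ^ d := by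
      refine (show ((q.lightNear P F l).card : ℝ) ≤ (nearCells q.N F (l + 1)
        (cubeDiam q.N / 2 ^ l * (4 / q.eps))).card by
          exact Nat.cast_le.2 (Finset.card_le_card (Finset.filter_subset _ _))).trans ?_
      refine (card_nearCells_le hN F (l + 1) (by positivity)).trans ?_
      rw [hFk]
      gcongr
      have h3 : 2 * (2 ^ (l + 1) * (cubeDiam q.N / 2 ^ l * (4 / q.eps))) =
          16 * cubeDiam q.N / q.eps := by
        rw [pow_succ]; field_simp; norm_num
      -- This absorbs the 3 of the packing bound: 16Δ/ε' + 3 ≤ 2^5 Δ/ε', the base of M.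
      have h4 : 2 ≤ cubeDiam q.N / q.eps := by
        rw [le_div_iff₀ heps]; linarith
      rw [h3, mul_div_assoc, mul_div_assoc]
      linarith
    gcongr
  calc _ ≤ ∑ l ∈ Finset.range (q.numLayers - 1), q.k * (2 ^ 5 * cubeDiam q.N / q.eps) ^ d *
        (q.gamma * q.lam * (2 * cubeDiam q.N) ^ 2) := Finset.sum_le_sum fun l _ => hone l
    _ = ((q.numLayers - 1 : ℕ) : ℝ) * (q.k * (2 ^ 5 * cubeDiam q.N / q.eps) ^ d *
        (q.gamma * q.lam * (2 * cubeDiam q.N) ^ 2)) := by simp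
    _ ≤ q.numLayers * (q.k * (2 ^ 5 * cubeDiam q.N / q.eps) ^ d *
        (q.gamma * q.lam * (2 * cubeDiam q.N) ^ 2)) := by
        gcongr
        exact Nat.sub_le _ _
    _ = q.eps * q.lam / 5 := by
        unfold gamma
        rw [hp]
        field_simp

/-- The total squared movement is small compared to the cost of any set of centers. -/
theorem integral_sq_map_sub_toRep_le (hH : q.IsHeavyTree P H) [IsProbabilityMeasure P]
    (hp : q.p = 2) (hN : IsAdmissibleNorm q.N) (hP : ∀ᵐ x ∂P, x ∈ unitDiamBall q.N)
    (c : ChoiceRule q.N) (hk : 0 < q.k) (heps : 0 < q.eps) (heps1 : q.eps ≤ 1 / 2)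
    (hlam : 0 < q.lam) (hγ : 0 < q.gamma) (hΔ : 1 ≤ cubeDiam q.N) {F : Finset (Fin d → ℝ)}
    (hFB : (F : Set (Fin d → ℝ)) ⊆ unitDiamBall q.N) (hFk : F.card = q.k)
    (hcost : q.lam ≤ 2 * cost q.N 2 P F) :
    ∫ x, q.N (x - q.toRep c H x) ^ 2 ∂P ≤ q.eps * cost q.N 2 P F := by
  have hF : F.Nonempty := Finset.card_pos.1 (by omega)
  have hi1 := integrable_distTo_sq hN hP hF hFB
  have hi2 : Integrable (fun x => ∑ l ∈ Finset.range (q.numLayers - 1),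
      ∑ b ∈ q.lightNear P F l, (cellIndex (l + 1) ⁻¹' {b}).indicator
        (fun _ => (cubeDiam q.N / 2 ^ l) ^ 2) x) P :=
    integrable_finsetSum _ fun l _ => integrable_finsetSum _ fun b _ =>
      integrable_indicator_cell _ _ _
  have hi3 : Integrable (fun x => q.eps * q.lam / 5 + q.eps / 5 * distTo q.N x F ^ 2) P :=
    (integrable_const _).add (hi1.const_mul _)
  calc ∫ x, q.N (x - q.toRep c H x) ^ 2 ∂P
      ≤ ∫ x, (q.eps * q.lam / 5 + q.eps / 5 * distTo q.N x F ^ 2 +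
        ∑ l ∈ Finset.range (q.numLayers - 1), ∑ b ∈ q.lightNear P F l,
          (cellIndex (l + 1) ⁻¹' {b}).indicator (fun _ => (cubeDiam q.N / 2 ^ l) ^ 2) x) ∂P := by
        refine integral_mono_ae (hH.integrable_sq_map_sub_toRep hN hP hγ hlam c)
          (hi3.add hi2) ?_
        filter_upwards [hP] with x hx
        exact hH.sq_map_sub_toRep_le hp hN c heps heps1 hlam (by linarith) hF hx
    _ = q.eps * q.lam / 5 + q.eps / 5 * cost q.N 2 P F +
        ∑ l ∈ Finset.range (q.numLayers - 1), ∑ b ∈ q.lightNear P F l,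
          P.real (cellIndex (l + 1) ⁻¹' {b}) * (cubeDiam q.N / 2 ^ l) ^ 2 := by
        rw [integral_add hi3 hi2,
          integral_add (integrable_const _) (hi1.const_mul _), integral_const,
          integral_const_mul, probReal_univ, one_smul,
          integral_finsetSum _ fun l _ => integrable_finsetSum _ fun b _ =>
            integrable_indicator_cell _ _ _]
        congr 1
        refine Finset.sum_congr rfl fun l _ => ?_
        rw [integral_finsetSum _ fun b _ => integrable_indicator_cell _ _ _]
        simp_rw [integral_indicator_cell]
    _ ≤ q.eps * cost q.N 2 P F := by
        -- Two terms ε'Λ/5, with Λ at most twice the cost, give 4/5 of the target; the distance term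
        -- gives the last fifth.
        have := hH.sum_lightNear_le (F := F) hp hN hk heps heps1 hlam hΔ hFk
        nlinarith

/-- The difference is at most 2ay + y², and 2ay is split by the weighted inequality (sa - y)² ≥ 0.
-/
theorem abs_sq_sub_sq_le {a b y s : ℝ} (hs : 0 < s) (ha : 0 ≤ a)
    (h : |b - a| ≤ y) : |b ^ 2 - a ^ 2| ≤ s * a ^ 2 + (1 / s + 1) * y ^ 2 := by
  have h1 := abs_le.1 h
  have h2 : 2 * a * y ≤ s * a ^ 2 + 1 / s * y ^ 2 := by
    have h3 := sq_nonneg (s * a - y)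
    have h4 : s * a ^ 2 + 1 / s * y ^ 2 - 2 * a * y = (s * a - y) ^ 2 / s := by
      field_simp; ring
    have h5 : 0 ≤ (s * a - y) ^ 2 / s := by positivity
    linarith
  have h6 : |b ^ 2 - a ^ 2| ≤ 2 * a * y + y ^ 2 := by
    rw [abs_le]
    constructor <;> nlinarith [h1.1, h1.2]
  linarith

/-- The image of `P` under the map to representatives is a coreset. -/
theorem isCoreset_map_toRep (hH : q.IsHeavyTree P H) [IsProbabilityMeasure P]
    (hp : q.p = 2) (hN : IsAdmissibleNorm q.N) (hP : ∀ᵐ x ∂P, x ∈ unitDiamBall q.N)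
    (c : ChoiceRule q.N) (hk : 0 < q.k) {ε : ℝ} (hε : 0 < ε) (hε1 : ε < 1)
    (heps : q.eps = ε ^ 2 / 2 ^ 6) (hlam : 0 < q.lam) (hγ : 0 < q.gamma)
    (hΔ : 1 ≤ cubeDiam q.N)
    (hcost : ∀ F : Finset (Fin d → ℝ), (F : Set (Fin d → ℝ)) ⊆ unitDiamBall q.N →
      F.card = q.k → q.lam ≤ 2 * cost q.N 2 P F) :
    IsCoreset q.N q.k 2 ε P (P.map (q.toRep c H)) (q.toRep c H '' unitDiamBall q.N) where
  isProbability := Measure.isProbabilityMeasure_map (measurable_toRep c H).aemeasurable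
  subset_ball := by
    rintro _ ⟨x, -, rfl⟩
    exact hH.toRep_mem_ball hN hP hγ hlam c x
  concentrated := by
    refine (ae_map_iff (measurable_toRep c H).aemeasurable
      (hH.finite_image_toRep c _).measurableSet).2 ?_
    filter_upwards [hP] with x hx using ⟨x, hx, rfl⟩
  cost_bounds := by
    intro F hFB hFk
    have hF : F.Nonempty := Finset.card_pos.1 (by omega)
    have heps0 : 0 < q.eps := by rw [heps]; positivity
    have hmove := hH.integral_sq_map_sub_toRep_le hp hN hP c hk heps0
      (by rw [heps]; nlinarith) hlam hγ hΔ hFB hFk (hcost F hFB hFk)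
    have hi1 := integrable_distTo_sq hN hP hF hFB
    have hi2 := hH.integrable_sq_map_sub_toRep hN hP hγ hlam c
    have hi3 : Integrable (fun x => distTo q.N (q.toRep c H x) F ^ 2) P := by
      refine Integrable.of_bound (((measurable_distTo hN F).comp
        (measurable_toRep c H)).pow_const 2).aestronglyMeasurable 1 ?_
      refine Filter.Eventually.of_forall fun x => ?_
      rw [Real.norm_of_nonneg (sq_nonneg _)]
      exact pow_le_one₀ (distTo_nonneg _)
        (distTo_le_one hF hFB (hH.toRep_mem_ball hN hP hγ hlam c x))
    have hmap : cost q.N 2 (P.map (q.toRep c H)) F =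
        ∫ x, distTo q.N (q.toRep c H x) F ^ 2 ∂P :=
      integral_map (measurable_toRep c H).aemeasurable
        ((measurable_distTo hN F).pow_const 2).aestronglyMeasurable
    have hcost0 : 0 ≤ cost q.N 2 P F := integral_nonneg fun x => sq_nonneg _
    have habs : |cost q.N 2 (P.map (q.toRep c H)) F - cost q.N 2 P F| ≤ ε * cost q.N 2 P F := by
      rw [hmap, cost, ← integral_sub hi3 hi1]
      calc |∫ x, (distTo q.N (q.toRep c H x) F ^ 2 - distTo q.N x F ^ 2) ∂P|
          ≤ ∫ x, |distTo q.N (q.toRep c H x) F ^ 2 - distTo q.N x F ^ 2| ∂P :=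
            abs_integral_le_integral_abs
        -- With s = ε/2 the movement is weighted by 2/ε + 1, which is why its accuracy must be of
        -- order ε².
        _ ≤ ∫ x, (ε / 2 * distTo q.N x F ^ 2 +
            (1 / (ε / 2) + 1) * q.N (x - q.toRep c H x) ^ 2) ∂P := by
            refine integral_mono (hi3.sub hi1).abs
              ((hi1.const_mul _).add (hi2.const_mul _)) fun x => ?_
            refine abs_sq_sub_sq_le (by positivity) (distTo_nonneg x) ?_
            have h1 := distTo_le_add (N := q.N) hF (q.toRep c H x) x
            have h2 := distTo_le_add (N := q.N) hF x (q.toRep c H x)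
            rw [map_sub_rev q.N] at h1
            rw [abs_le]
            constructor <;> linarith
        _ = ε / 2 * cost q.N 2 P F +
            (1 / (ε / 2) + 1) * ∫ x, q.N (x - q.toRep c H x) ^ 2 ∂P := by
            rw [integral_add (hi1.const_mul _) (hi2.const_mul _), integral_const_mul,
              integral_const_mul, cost]
        _ ≤ ε / 2 * cost q.N 2 P F + (1 / (ε / 2) + 1) * (q.eps * cost q.N 2 P F) := by gcongr
        _ = (ε / 2 + ε / 32 + ε ^ 2 / 64) * cost q.N 2 P F := by
            rw [heps]; field_simp; ring
        _ ≤ ε * cost q.N 2 P F := by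
            gcongr
            nlinarith
    have := abs_le.1 habs
    constructor <;> linarith

end IsHeavyTree

end Params


/-! ### The optimal value -/

section OptCost

variable {d k : ℕ} {N : Seminorm ℝ (Fin d → ℝ)} {P : Measure (Fin d → ℝ)}

theorem cost_nonneg (F : Finset (Fin d → ℝ)) : 0 ≤ cost N 2 P F :=
  integral_nonneg fun _ => sq_nonneg _

theorem optCost_le_cost {F : Finset (Fin d → ℝ)}
    (hFB : (F : Set (Fin d → ℝ)) ⊆ unitDiamBall N) (hFk : F.card = k) :
    optCost N k 2 P ≤ cost N 2 P F :=
  csInf_le ⟨0, by rintro _ ⟨F, -, -, rfl⟩; exact cost_nonneg F⟩ ⟨F, hFB, hFk, rfl⟩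

/-- Serves to exclude d = 0, where the norm vanishes, and k = 0, where the distance to no centers is
0 by default. -/
theorem optCost_nonpos_of_cost_eq_zero
    (h : ∀ F : Finset (Fin d → ℝ), F.card = k → cost N 2 P F = 0) : optCost N k 2 P ≤ 0 := by
  refine Real.sInf_nonpos ?_
  rintro _ ⟨F, -, hF, rfl⟩
  exact (h F hF).le

theorem dim_pos_of_optCost_pos (h : 0 < optCost N k 2 P) : 0 < d := by
  by_contra hd
  obtain rfl : d = 0 := by omega
  refine absurd (optCost_nonpos_of_cost_eq_zero fun F _ => ?_) (not_le.2 h)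
  have : ∀ x, distTo N x F = 0 := by
    intro x
    have h0 : ∀ y : Fin 0 → ℝ, N y = 0 := fun y => by
      rw [Subsingleton.elim y 0, map_zero]
    simp [distTo, h0]
  simp [cost, this]

theorem card_pos_of_optCost_pos (h : 0 < optCost N k 2 P) : 0 < k := by
  by_contra hk
  obtain rfl : k = 0 := by omega
  refine absurd (optCost_nonpos_of_cost_eq_zero fun F hF => ?_) (not_le.2 h)
  have : ∀ x, distTo N x F = 0 := by
    intro x
    rw [Finset.card_eq_zero.1 hF]
    simp [distTo]
  simp [cost, this]

/-- The points i/(2k) e₁ with i < k. They make the infimum range over a nonempty set, and the center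
0 bounds OPT. -/
theorem exists_centers (hN : IsAdmissibleNorm N) (hd : 0 < d) (hk : 0 < k) :
    ∃ F : Finset (Fin d → ℝ), (F : Set (Fin d → ℝ)) ⊆ unitDiamBall N ∧ F.card = k ∧ 0 ∈ F := by
  classical
  have hk' : (0 : ℝ) < k := by exact_mod_cast hk
  set g : ℕ → Fin d → ℝ := fun i => Pi.single ⟨0, hd⟩ ((i : ℝ) / (2 * k)) with hg
  have hinj : Function.Injective g := by
    intro i j hij
    have h1 : (i : ℝ) / (2 * k) = j / (2 * k) := Pi.single_injective _ hij
    rw [div_left_inj' (by positivity)] at h1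
    exact_mod_cast h1
  refine ⟨(Finset.range k).image g, ?_, ?_, ?_⟩
  · intro x hx
    simp only [Finset.coe_image, Set.mem_image, Finset.coe_range, Set.mem_Iio] at hx
    obtain ⟨i, hi, rfl⟩ := hx
    change N (g i) ≤ 1 / 2
    rw [hg, hN.map_single, abs_of_nonneg (by positivity), div_le_div_iff₀ (by positivity) two_pos]
    have : (i : ℝ) ≤ k := by exact_mod_cast hi.le
    linarith
  · rw [Finset.card_image_of_injective _ hinj, Finset.card_range]
  · exact Finset.mem_image.2 ⟨0, Finset.mem_range.2 hk, by simp [hg]⟩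

/-- Keeps Δ²/(ε OPT) at least 4 and its logarithm at least 1, so that additive constants can be
absorbed. -/
theorem optCost_le_quarter [IsProbabilityMeasure P] (hN : IsAdmissibleNorm N) (hd : 0 < d)
    (hk : 0 < k) (hP : ∀ᵐ x ∂P, x ∈ unitDiamBall N) : optCost N k 2 P ≤ 1 / 4 := by
  obtain ⟨F, hFB, hFk, h0⟩ := exists_centers (k := k) hN hd hk
  refine (optCost_le_cost hFB hFk).trans ?_
  calc cost N 2 P F ≤ ∫ _x, (1 / 4 : ℝ) ∂P := by
        refine integral_mono_ae
          (Params.IsHeavyTree.integrable_distTo_sq hN hP ⟨0, h0⟩ hFB) (integrable_const _) ?_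
        filter_upwards [hP] with x hx
        have h1 := distTo_le (N := N) x h0
        rw [sub_zero] at h1
        have h2 : distTo N x F ≤ 1 / 2 := h1.trans hx
        have h3 := distTo_nonneg (N := N) (F := F) x
        nlinarith
    _ = 1 / 4 := by simp

/-- No minimizer is needed: the factor 2 only affects the constant of the size bound. -/
theorem exists_cost_le_two_mul (hN : IsAdmissibleNorm N) (h : 0 < optCost N k 2 P) :
    ∃ F : Finset (Fin d → ℝ), (F : Set (Fin d → ℝ)) ⊆ unitDiamBall N ∧ F.card = k ∧
      cost N 2 P F ≤ 2 * optCost N k 2 P := by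
  obtain ⟨F, hFB, hFk, -⟩ := exists_centers (k := k) hN (dim_pos_of_optCost_pos h)
    (card_pos_of_optCost_pos h)
  obtain ⟨_, ⟨F', hFB', hFk', rfl⟩, hlt⟩ := exists_lt_of_csInf_lt
    (s := {c | ∃ F : Finset (Fin d → ℝ), (F : Set (Fin d → ℝ)) ⊆ unitDiamBall N ∧ F.card = k ∧
      c = cost N 2 P F}) ⟨_, F, hFB, hFk, rfl⟩
    (show optCost N k 2 P < 2 * optCost N k 2 P by linarith)
  exact ⟨F', hFB', hFk', hlt.le⟩

end OptCost

/-! ### Size and sample complexity -/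

/-- Here a bounds 1/v and T the logarithms. There are at most 2aT + 1 candidates, and 648 · 5aT ·
4a²t²/ρ² = 12960 a³t²T/ρ²; the first phase and the rounding fit into the remaining 40. -/
theorem HHParams.card_sampleIdx_le {h : HHParams} {a t ρ δ T : ℝ} (ha : 1 ≤ a) (ht : 1 ≤ t)
    (hρ : 0 < ρ) (hρ1 : ρ ≤ 1) (hδ : 0 < δ) (hT : 1 ≤ T) (hT' : Real.log (4 * t * a / δ) ≤ T)
    (hv : 1 / a ≤ h.v) (herr : h.err = h.v / 2) (hrho : h.rho = ρ / t) (hdelta : h.delta = δ / t)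
    (K : ℕ) : (Fintype.card (h.SampleIdx K) : ℝ) ≤ 13000 * a ^ 3 * t ^ 2 * T / ρ ^ 2 := by
  have ha0 : 0 < a := by linarith
  have ht0 : 0 < t := by linarith
  have hv0 : 0 < h.v := lt_of_lt_of_le (by positivity) hv
  have hvinv : 1 / h.v ≤ a := by
    rw [div_le_iff₀ hv0]; rw [div_le_iff₀ ha0] at hv; linarith
  have hθ : h.threshold ≤ 2 * a * T := by
    have h1 : h.v - h.err = h.v / 2 := by rw [herr]; ring
    have h2 : Real.log (2 / (h.delta * (h.v / 2))) ≤ T := by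
      refine le_trans (Real.log_le_log ?_ ?_) hT'
      · rw [hdelta]; positivity
      · rw [hdelta]
        calc 2 / (δ / t * (h.v / 2)) = 4 * t * (1 / h.v) / δ := by field_simp; norm_num
          _ ≤ 4 * t * a / δ := by gcongr
    rw [threshold, h1]
    calc Real.log (2 / (h.delta * (h.v / 2))) / (h.v / 2) ≤ T / (h.v / 2) := by gcongr
      _ = 2 * (1 / h.v) * T := by field_simp
      _ ≤ 2 * a * T := by gcongr
  have hceil : (⌈h.threshold⌉₊ : ℝ) ≤ 2 * a * T + 1 := by
    refine (Nat.cast_le.2 (Nat.ceil_mono hθ)).trans ?_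
    exact (Nat.ceil_lt_add_one (by positivity)).le
  have hcs : (h.candSize K : ℝ) ≤ 2 * a * T + 1 := by
    unfold candSize
    split_ifs
    · push_cast; positivity
    · exact hceil
  have hcb : (h.candBound K : ℝ) ≤ 2 * a * T + 1 := by
    unfold candBound
    split_ifs with hc
    · linarith
    · exact hceil
  have haT : 1 ≤ a * T := by nlinarith
  have hl2 : Real.log 2 ≤ 1 := by linarith [Real.log_two_lt_d9]
  have hl2' : 0 ≤ Real.log 2 := Real.log_nonneg (by norm_num)
  have hes : (h.estSize (h.candBound K) : ℝ) ≤
      648 * (5 * (a * T)) * (4 * a ^ 2 * t ^ 2 / ρ ^ 2) + 1 := by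
    have h1 : 648 * Real.log (2 / h.delta) + 648 * ((h.candBound K : ℝ) + 1) * Real.log 2 ≤
        648 * (5 * (a * T)) := by
      have h2 : Real.log (2 / h.delta) ≤ T := by
        refine le_trans (Real.log_le_log ?_ ?_) hT'
        · rw [hdelta]; positivity
        · rw [hdelta]
          calc 2 / (δ / t) = 2 * t * 1 / δ := by field_simp
            _ ≤ 4 * t * a / δ := by gcongr; norm_num
      have h3 : ((h.candBound K : ℝ) + 1) * Real.log 2 ≤ (2 * a * T + 1 + 1) * 1 := by gcongr
      have h4 : T ≤ a * T := by nlinarith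
      linarith
    have h2 : 1 / (h.rho ^ 2 * h.err ^ 2) ≤ 4 * a ^ 2 * t ^ 2 / ρ ^ 2 := by
      rw [hrho, herr]
      calc 1 / ((ρ / t) ^ 2 * (h.v / 2) ^ 2) = 4 * (1 / h.v) ^ 2 * t ^ 2 / ρ ^ 2 := by
            field_simp; norm_num
        _ ≤ _ := by gcongr
    have h3 : (648 * Real.log (2 / h.delta) + 648 * ((h.candBound K : ℝ) + 1) * Real.log 2) /
        (h.rho ^ 2 * h.err ^ 2) ≤ 648 * (5 * (a * T)) * (4 * a ^ 2 * t ^ 2 / ρ ^ 2) := by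
      rw [div_eq_mul_one_div]
      gcongr
    unfold estSize
    refine (Nat.cast_le.2 (Nat.ceil_mono h3)).trans ?_
    exact (Nat.ceil_lt_add_one (by positivity)).le
  rw [Fintype.card_sum, Fintype.card_fin, Fintype.card_fin]
  push_cast
  have hbig : a * T ≤ a ^ 3 * t ^ 2 * T / ρ ^ 2 := by
    rw [le_div_iff₀ (by positivity)]
    have h1 : ρ ^ 2 ≤ 1 := pow_le_one₀ hρ.le hρ1
    have h2 : 1 ≤ a ^ 2 * t ^ 2 := one_le_mul_of_one_le_of_one_le (one_le_pow₀ ha) (one_le_pow₀ ht)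
    calc a * T * ρ ^ 2 ≤ a * T * 1 := by gcongr
      _ ≤ a * T * (a ^ 2 * t ^ 2) := by gcongr
      _ = a ^ 3 * t ^ 2 * T := by ring
  have heq : 648 * (5 * (a * T)) * (4 * a ^ 2 * t ^ 2 / ρ ^ 2) =
      12960 * (a ^ 3 * t ^ 2 * T / ρ ^ 2) := by ring
  have heq' : 13000 * a ^ 3 * t ^ 2 * T / ρ ^ 2 = 13000 * (a ^ 3 * t ^ 2 * T / ρ ^ 2) := by ring
  rw [heq] at hes
  rw [heq']
  linarith

/-- The assumptions on the numerical parameters of `k`-means. -/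
structure NumericBounds (β ε O Δ lam : ℝ) : Prop where
  one_le_beta : 1 ≤ β
  eps_pos : 0 < ε
  eps_lt : ε < 1
  opt_pos : 0 < O
  opt_le : O ≤ 1 / 4
  one_le_diam : 1 ≤ Δ
  le_lam : O / (β * (1 + ε)) ≤ lam
  lam_le : lam ≤ (1 + ε) * O

namespace NumericBounds

variable {β ε O Δ lam : ℝ} (hb : NumericBounds β ε O Δ lam)
include hb

theorem le_two_mul_lam : O ≤ 2 * β * lam := by
  have h1 := hb.le_lam
  have h2 := hb.one_le_beta
  have h3 := hb.eps_pos
  have h4 := hb.eps_lt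
  have h5 := hb.opt_pos
  rw [div_le_iff₀ (by positivity)] at h1
  have hl : 0 < lam := by
    by_contra hcon
    have : lam * (β * (1 + ε)) ≤ 0 := mul_nonpos_of_nonpos_of_nonneg (not_lt.1 hcon) (by positivity)
    linarith
  calc O ≤ lam * (β * (1 + ε)) := h1
    _ ≤ lam * (β * 2) := by gcongr; linarith
    _ = 2 * β * lam := by ring

theorem lam_pos : 0 < lam := by
  have h1 := hb.le_two_mul_lam
  have h2 := hb.one_le_beta
  have h3 := hb.opt_pos
  by_contra hcon
  have : 2 * β * lam ≤ 0 := mul_nonpos_of_nonneg_of_nonpos (by positivity) (not_lt.1 hcon)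
  linarith

theorem lam_le_two_mul : lam ≤ 2 * O := by
  have := hb.lam_le
  nlinarith [hb.eps_lt, hb.opt_pos]

theorem four_le : 4 ≤ Δ ^ 2 / (ε * O) := by
  have h1 := hb.eps_pos
  have h2 := hb.opt_pos
  rw [le_div_iff₀ (by positivity)]
  have h3 : ε * O ≤ 1 * (1 / 4) := by gcongr; exacts [hb.eps_lt.le, hb.opt_le]
  nlinarith [hb.one_le_diam]

theorem one_le_log : 1 ≤ Real.log (Δ ^ 2 / (ε * O)) := by
  have h1 : Real.log 4 ≤ Real.log (Δ ^ 2 / (ε * O)) := Real.log_le_log (by norm_num) hb.four_le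
  have h2 : Real.log 4 = 2 * Real.log 2 := by
    rw [show (4 : ℝ) = 2 ^ 2 by norm_num, Real.log_pow]; norm_num
  linarith [Real.log_two_gt_d9]

/-- The number of layers is logarithmic. -/
theorem ceil_layers_bounds :
    1 ≤ ⌈1 / ((2 : ℕ) : ℝ) * Real.logb 2 (5 * Δ ^ 2 / (ε ^ 2 / 2 ^ 6 * lam)) + 1⌉₊ ∧
    (⌈1 / ((2 : ℕ) : ℝ) * Real.logb 2 (5 * Δ ^ 2 / (ε ^ 2 / 2 ^ 6 * lam)) + 1⌉₊ : ℝ) ≤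
      (Real.log (640 * β) + 4) * Real.log (Δ ^ 2 / (ε * O)) := by
  have hε := hb.eps_pos
  have hε1 := hb.eps_lt
  have hO := hb.opt_pos
  have hO1 := hb.opt_le
  have hΔ := hb.one_le_diam
  have hβ := hb.one_le_beta
  have hlam := hb.lam_pos
  have hl1 := hb.one_le_log
  set Y := 5 * Δ ^ 2 / (ε ^ 2 / 2 ^ 6 * lam) with hY
  set X := Δ ^ 2 / (ε * O) with hX
  have hX4 : 4 ≤ X := hb.four_le
  have hY1 : 1 ≤ Y := by
    rw [hY, le_div_iff₀ (by positivity)]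
    have h1 : ε ^ 2 / 2 ^ 6 * lam ≤ 1 ^ 2 / 2 ^ 6 * (2 * O) := by
      gcongr; exact hb.lam_le_two_mul
    nlinarith
  -- Here 320 = 5 · 2^6, and 1/Λ ≤ 2β/OPT doubles it; one factor OPT is then traded for Δ² to
  -- complete a square.
  have hYle : Y ≤ 640 * β * X ^ 2 := by
    have h1 : 1 / lam ≤ 2 * β / O := by
      rw [div_le_div_iff₀ hlam hO]; linarith [hb.le_two_mul_lam]
    calc Y = 320 * Δ ^ 2 / ε ^ 2 * (1 / lam) := by rw [hY]; field_simp; norm_num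
      _ ≤ 320 * Δ ^ 2 / ε ^ 2 * (2 * β / O) := by gcongr
      _ = 640 * β * (Δ ^ 2 * O / (ε * O) ^ 2) := by field_simp; norm_num
      _ ≤ 640 * β * (Δ ^ 2 * Δ ^ 2 / (ε * O) ^ 2) := by
          gcongr
          nlinarith
      _ = 640 * β * X ^ 2 := by rw [hX]; ring
  have hlogY0 : 0 ≤ Real.logb 2 Y := Real.logb_nonneg one_lt_two hY1
  constructor
  · refine Nat.one_le_iff_ne_zero.2 (Nat.ceil_pos.2 (by positivity)).ne'
  · refine (Nat.ceil_lt_add_one (by positivity)).le.trans ?_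
    have hlogY : Real.log Y ≤ Real.log (640 * β) + 2 * Real.log X := by
      refine (Real.log_le_log (by linarith) hYle).trans (le_of_eq ?_)
      rw [Real.log_mul (by positivity) (by positivity), Real.log_pow]
      norm_num
    have h640 : 0 ≤ Real.log (640 * β) := Real.log_nonneg (by linarith)
    have h2 : Real.logb 2 Y ≤ 2 * Real.log Y := by
      have := Real.log_nonneg hY1
      rw [Real.logb, div_le_iff₀ (Real.log_pos one_lt_two)]
      nlinarith [Real.log_two_gt_d9]
    have h3 : Real.log (640 * β) ≤ Real.log (640 * β) * Real.log X := by nlinarith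
    push_cast
    linarith

end NumericBounds


/-! ### The bounds for the parameters of k-means -/

section KMeans

variable {d k : ℕ} {N : Seminorm ℝ (Fin d → ℝ)} {β ε ρ δ O lam : ℝ}

theorem kMeans_numLayers_bounds (hb : NumericBounds β ε O (cubeDiam N) lam) :
    1 ≤ (kMeansParams k N ε ρ δ lam).numLayers ∧
    ((kMeansParams k N ε ρ δ lam).numLayers : ℝ) ≤
      (Real.log (640 * β) + 4) * Real.log (cubeDiam N ^ 2 / (ε * O)) :=
  hb.ceil_layers_bounds

/-- Source of the exponents: M becomes 2^(11d) Δ^d/ε^(2d), the factor (2Δ)²/ε' brings Δ²/ε², and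
1280 = 5 · 2^6 · 4. -/
theorem kMeans_inv_gamma (hb : NumericBounds β ε O (cubeDiam N) lam) (hk : 0 < k) :
    1 / ((kMeansParams k N ε ρ δ lam).gamma * lam) =
      1280 * (kMeansParams k N ε ρ δ lam).numLayers *
        (k * 2 ^ (11 * d) * cubeDiam N ^ (d + 2) / (ε ^ (2 * d + 2) * lam)) := by
  have ht : (0 : ℝ) < (kMeansParams k N ε ρ δ lam).numLayers := by
    exact_mod_cast (kMeans_numLayers_bounds (k := k) (ρ := ρ) (δ := δ) hb).1
  have hk' : (0 : ℝ) < k := by exact_mod_cast hk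
  have hε := hb.eps_pos
  have hlam := hb.lam_pos
  have hΔ : 0 < cubeDiam N := lt_of_lt_of_le one_pos hb.one_le_diam
  have hM : (2 ^ 5 * cubeDiam N / (ε ^ 2 / 2 ^ 6)) ^ d =
      2 ^ (11 * d) * cubeDiam N ^ d / ε ^ (2 * d) := by
    rw [pow_mul 2 11 d, pow_mul ε 2 d, ← mul_pow, ← div_pow]
    congr 1
    field_simp
  simp only [Params.gamma]
  set t := (kMeansParams k N ε ρ δ lam).numLayers
  simp only [kMeansParams]
  rw [hM, pow_add _ d 2, pow_add ε (2 * d) 2]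
  field_simp
  norm_num

theorem kMeans_gamma_pos (hb : NumericBounds β ε O (cubeDiam N) lam) (hk : 0 < k) :
    0 < (kMeansParams k N ε ρ δ lam).gamma := by
  have ht : (0 : ℝ) < (kMeansParams k N ε ρ δ lam).numLayers := by
    exact_mod_cast (kMeans_numLayers_bounds (k := k) (ρ := ρ) (δ := δ) hb).1
  have hk' : (0 : ℝ) < k := by exact_mod_cast hk
  have hε := hb.eps_pos
  have hΔ : 0 < cubeDiam N := lt_of_lt_of_le one_pos hb.one_le_diam
  simp only [Params.gamma]
  set t := (kMeansParams k N ε ρ δ lam).numLayers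
  simp only [kMeansParams]
  positivity

theorem kMeans_hh_valid (hb : NumericBounds β ε O (cubeDiam N) lam) (hk : 0 < k) (hρ : 0 < ρ)
    (hρ1 : ρ ≤ 1) (hδ : 0 < δ) (hδ1 : δ ≤ 1) (i : ℕ) :
    ((kMeansParams k N ε ρ δ lam).hh i).Valid := by
  have ht1 := (kMeans_numLayers_bounds (k := k) (ρ := ρ) (δ := δ) hb).1
  have ht : (1 : ℝ) ≤ (kMeansParams k N ε ρ δ lam).numLayers := by exact_mod_cast ht1
  have hγ := kMeans_gamma_pos (ρ := ρ) (δ := δ) hb hk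
  have hlam := hb.lam_pos
  have hv : 0 < (kMeansParams k N ε ρ δ lam).gamma * lam *
      2 ^ ((kMeansParams k N ε ρ δ lam).p * i) := by positivity
  exact
    { err_pos := half_pos hv
      err_lt := half_lt_self hv
      rho_pos := div_pos hρ (by linarith)
      rho_le := div_le_one_of_le₀ (hρ1.trans ht) (by linarith)
      delta_pos := div_pos hδ (by linarith)
      delta_le := div_le_one_of_le₀ (hδ1.trans ht) (by linarith) }

theorem inv_gamma_le (hb : NumericBounds β ε O (cubeDiam N) lam) (hk : 0 < k) :
    1 / ((kMeansParams k N ε ρ δ lam).gamma * lam) ≤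
      2560 * β * (kMeansParams k N ε ρ δ lam).numLayers *
        (k * 2 ^ (11 * d) * cubeDiam N ^ (d + 2) / (ε ^ (2 * d + 2) * O)) := by
  rw [kMeans_inv_gamma hb hk]
  have hlam := hb.lam_pos
  have hε := hb.eps_pos
  have hO := hb.opt_pos
  have hΔ : 0 < cubeDiam N := lt_of_lt_of_le one_pos hb.one_le_diam
  set t : ℝ := ((kMeansParams k N ε ρ δ lam).numLayers : ℝ) with ht
  have h1 : 1 / lam ≤ 2 * β / O := by
    rw [div_le_div_iff₀ hlam hO]; linarith [hb.le_two_mul_lam]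
  calc 1280 * t * (k * 2 ^ (11 * d) * cubeDiam N ^ (d + 2) / (ε ^ (2 * d + 2) * lam))
      = 1280 * t * (k * 2 ^ (11 * d) * cubeDiam N ^ (d + 2) / ε ^ (2 * d + 2)) * (1 / lam) := by
        field_simp
    _ ≤ 1280 * t * (k * 2 ^ (11 * d) * cubeDiam N ^ (d + 2) / ε ^ (2 * d + 2)) * (2 * β / O) := by
        gcongr
    _ = _ := by field_simp; ring

/-- The bound for the number of leaves, in closed form. -/
theorem kMeans_size_le (hb : NumericBounds β ε O (cubeDiam N) lam) (hk : 0 < k) {c : ℝ}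
    (hc : c ≤ 2 * O) :
    ((kMeansParams k N ε ρ δ lam).numLayers : ℝ) * (k * (2 * cubeDiam N + 3) ^ d) +
      2 * c / ((kMeansParams k N ε ρ δ lam).gamma * lam * cubeDiam N ^ 2) ≤
    (10240 * β + 1) * (Real.log (640 * β) + 4) *
      (k * 2 ^ (11 * d) * cubeDiam N ^ (d + 2) / ε ^ (2 * d + 2) *
        Real.log (cubeDiam N ^ 2 / (ε * O))) := by
  have hinv := inv_gamma_le (ρ := ρ) (δ := δ) hb hk
  have hlayers := (kMeans_numLayers_bounds (k := k) (ρ := ρ) (δ := δ) hb).2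
  have hγ := kMeans_gamma_pos (ρ := ρ) (δ := δ) hb hk
  have hlam := hb.lam_pos
  have hε := hb.eps_pos
  have hO := hb.opt_pos
  have hβ := hb.one_le_beta
  have hΔ1 := hb.one_le_diam
  set Δ := cubeDiam N
  have hΔ : 0 < Δ := by linarith
  set t : ℝ := ((kMeansParams k N ε ρ δ lam).numLayers : ℝ) with ht
  set γ := (kMeansParams k N ε ρ δ lam).gamma
  set S := k * 2 ^ (11 * d) * Δ ^ (d + 2) / ε ^ (2 * d + 2) with hS
  have ht0 : 0 ≤ t := Nat.cast_nonneg _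
  have hS0 : 0 ≤ S := by positivity
  have h1 : k * (2 * Δ + 3) ^ d ≤ S := by
    rw [hS, le_div_iff₀ (by positivity)]
    calc k * (2 * Δ + 3) ^ d * ε ^ (2 * d + 2) ≤ k * (2 ^ 11 * Δ) ^ d * 1 := by
          gcongr
          · linarith
          · exact pow_le_one₀ hε.le hb.eps_lt.le
      _ = k * 2 ^ (11 * d) * Δ ^ d := by rw [mul_pow, ← pow_mul]; ring
      _ ≤ k * 2 ^ (11 * d) * Δ ^ (d + 2) := by
          gcongr
          omega
  have h2 : 2 * c / (γ * lam * Δ ^ 2) ≤ 10240 * β * t * S := by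
    calc 2 * c / (γ * lam * Δ ^ 2) ≤ 2 * (2 * O) / (γ * lam * 1) := by
          gcongr
          exact one_le_pow₀ hΔ1
      _ = 4 * O * (1 / (γ * lam)) := by ring
      _ ≤ 4 * O * (2560 * β * t * (k * 2 ^ (11 * d) * Δ ^ (d + 2) / (ε ^ (2 * d + 2) * O))) := by
          gcongr
      _ = 10240 * β * t * S := by rw [hS]; field_simp; ring
  calc t * (k * (2 * Δ + 3) ^ d) + 2 * c / (γ * lam * Δ ^ 2) ≤ t * S + 10240 * β * t * S := by
        gcongr
    _ = (10240 * β + 1) * t * S := by ring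
    _ ≤ (10240 * β + 1) * ((Real.log (640 * β) + 4) * Real.log (Δ ^ 2 / (ε * O))) * S := by
        gcongr
    _ = _ := by ring

/-- Targets grow with the level, so a bound for 1/(γΛ) serves every layer; summing over the layers
adds the third factor t. -/
theorem kMeans_sampleComplexity_le_layers (hb : NumericBounds β ε O (cubeDiam N) lam) (hk : 0 < k)
    (hρ : 0 < ρ) (hρ1 : ρ ≤ 1) (hδ : 0 < δ) {a T : ℝ} (ha : 1 ≤ a) (hT : 1 ≤ T)
    (hγa : 1 / ((kMeansParams k N ε ρ δ lam).gamma * lam) ≤ a)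
    (hT' : Real.log (4 * (kMeansParams k N ε ρ δ lam).numLayers * a / δ) ≤ T) :
    ((kMeansParams k N ε ρ δ lam).sampleComplexity : ℝ) ≤
      13000 * a ^ 3 * ((kMeansParams k N ε ρ δ lam).numLayers : ℝ) ^ 3 * T / ρ ^ 2 := by
  have ht1 := (kMeans_numLayers_bounds (k := k) (ρ := ρ) (δ := δ) hb).1
  have ht : (1 : ℝ) ≤ (kMeansParams k N ε ρ δ lam).numLayers := by exact_mod_cast ht1
  have hγ := kMeans_gamma_pos (ρ := ρ) (δ := δ) hb hk
  have hlam := hb.lam_pos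
  have hone : ∀ l : Fin ((kMeansParams k N ε ρ δ lam).numLayers - 1),
      (Fintype.card (((kMeansParams k N ε ρ δ lam).hh (l + 1)).SampleIdx
        (grid d (l + 1)).card) : ℝ) ≤
      13000 * a ^ 3 * ((kMeansParams k N ε ρ δ lam).numLayers : ℝ) ^ 2 * T / ρ ^ 2 := by
    intro l
    refine HHParams.card_sampleIdx_le ha ht hρ hρ1 hδ hT hT' ?_ rfl rfl rfl _
    have h1 : 1 / a ≤ (kMeansParams k N ε ρ δ lam).gamma * lam := by
      rw [div_le_iff₀ (by linarith)]
      rw [div_le_iff₀ (by positivity)] at hγa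
      linarith
    refine h1.trans ?_
    change _ ≤ (kMeansParams k N ε ρ δ lam).gamma * lam *
      2 ^ ((kMeansParams k N ε ρ δ lam).p * ((l : ℕ) + 1))
    exact le_mul_of_one_le_right (by positivity) (one_le_pow₀ one_le_two)
  rw [Params.sampleComplexity, Fintype.card_sigma]
  push_cast
  set t := (kMeansParams k N ε ρ δ lam).numLayers with htdef
  calc _ ≤ ∑ _l : Fin (t - 1), 13000 * a ^ 3 * (t : ℝ) ^ 2 * T / ρ ^ 2 :=
        Finset.sum_le_sum fun l _ => hone l
    _ = ((t - 1 : ℕ) : ℝ) * (13000 * a ^ 3 * (t : ℝ) ^ 2 * T / ρ ^ 2) := by simp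
    _ ≤ t * (13000 * a ^ 3 * (t : ℝ) ^ 2 * T / ρ ^ 2) := by
        gcongr
        exact Nat.sub_le _ _
    _ = _ := by ring

/-- The constant of the sample complexity. -/
def sampleConst (β : ℝ) : ℝ :=
  13000 * (2560 * β) ^ 3 * (Real.log (640 * β) + 4) ^ 6 *
    (Real.log (10240 * β) + 2 * (Real.log (640 * β) + 4) + 2)

/-- Up to β and t, 1/(γΛ) is A, and the main term is G = A³L/ρ². Of the seven logarithms of G, six
come from t^6 (three from the cube of 1/(γΛ), three from the layers) and one from T. -/
theorem kMeans_sampleComplexity_le (hb : NumericBounds β ε O (cubeDiam N) lam) (hk : 0 < k)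
    (hρ : 0 < ρ) (hρ1 : ρ ≤ 1) (hδ : 0 < δ) (hδ1 : δ < 1 / 3) :
    ((kMeansParams k N ε ρ δ lam).sampleComplexity : ℝ) ≤
      sampleConst β * ((k : ℝ) ^ 3 * 2 ^ (33 * d) * cubeDiam N ^ (3 * d + 6) /
          (ρ ^ 2 * ε ^ (6 * d + 6) * O ^ 3) * Real.log (1 / δ)) *
        Real.log ((k : ℝ) ^ 3 * 2 ^ (33 * d) * cubeDiam N ^ (3 * d + 6) /
          (ρ ^ 2 * ε ^ (6 * d + 6) * O ^ 3) * Real.log (1 / δ)) ^ 7 := by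
  have hinv := inv_gamma_le (ρ := ρ) (δ := δ) hb hk
  have hlayers := kMeans_numLayers_bounds (k := k) (ρ := ρ) (δ := δ) hb
  have hcount := fun (a T : ℝ) => kMeans_sampleComplexity_le_layers (a := a) (T := T) hb hk hρ hρ1 hδ
  have hk1 : (1 : ℝ) ≤ k := by exact_mod_cast hk
  have hε := hb.eps_pos
  have hε1 := hb.eps_lt
  have hO := hb.opt_pos
  have hO1 := hb.opt_le
  have hβ := hb.one_le_beta
  have hΔ1 := hb.one_le_diam
  have hlogX := hb.one_le_log
  have hX4 := hb.four_le
  set Δ := cubeDiam N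
  have hΔ : 0 < Δ := by linarith
  set t : ℝ := ((kMeansParams k N ε ρ δ lam).numLayers : ℝ) with ht
  have ht1 : 1 ≤ t := by rw [ht]; exact_mod_cast hlayers.1
  set A := k * 2 ^ (11 * d) * Δ ^ (d + 2) / (ε ^ (2 * d + 2) * O) with hA
  set X := Δ ^ 2 / (ε * O) with hX
  have hXA : X ≤ A := by
    rw [hX, hA]
    have h1 : ε ^ (2 * d + 2) ≤ ε := by
      simpa using pow_le_pow_of_le_one hε.le hε1.le (show 1 ≤ 2 * d + 2 by omega)
    have h2 : Δ ^ 2 ≤ Δ ^ (d + 2) := pow_le_pow_right₀ hΔ1 (by omega)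
    have h3 : (1 : ℝ) ≤ k * 2 ^ (11 * d) :=
      one_le_mul_of_one_le_of_one_le hk1 (one_le_pow₀ one_le_two)
    have h4 : Δ ^ 2 ≤ k * 2 ^ (11 * d) * Δ ^ (d + 2) :=
      h2.trans (le_mul_of_one_le_left (by positivity) h3)
    gcongr
  have hA1 : 1 ≤ A := by linarith
  have hL1 : 1 ≤ Real.log (1 / δ) := by
    have h1 : Real.log (Real.exp 1) ≤ Real.log (1 / δ) := by
      refine Real.log_le_log (Real.exp_pos 1) ?_
      rw [le_div_iff₀ hδ]
      nlinarith [Real.exp_one_lt_d9, Real.exp_pos 1]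
    rwa [Real.log_exp] at h1
  set L := Real.log (1 / δ) with hL
  have hG : (k : ℝ) ^ 3 * 2 ^ (33 * d) * Δ ^ (3 * d + 6) / (ρ ^ 2 * ε ^ (6 * d + 6) * O ^ 3) * L =
      A ^ 3 / ρ ^ 2 * L := by
    rw [hA, div_pow, mul_pow, mul_pow, mul_pow, ← pow_mul, ← pow_mul, ← pow_mul,
      show 11 * d * 3 = 33 * d by ring, show (d + 2) * 3 = 3 * d + 6 by ring,
      show (2 * d + 2) * 3 = 6 * d + 6 by ring]
    field_simp
  rw [hG]
  set G := A ^ 3 / ρ ^ 2 * L with hGdef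
  have hAG : A ≤ G := by
    have h1 : ρ ^ 2 ≤ 1 := pow_le_one₀ hρ.le hρ1
    calc A ≤ A ^ 3 := le_self_pow₀ hA1 (by norm_num)
      _ ≤ A ^ 3 / ρ ^ 2 := le_div_self (by positivity) (by positivity) h1
      _ ≤ G := le_mul_of_one_le_right (by positivity) hL1
  set l := Real.log G with hl
  have hAl : Real.log A ≤ l := Real.log_le_log (by linarith) hAG
  have hXl : Real.log X ≤ l := (Real.log_le_log (by linarith) hXA).trans hAl
  have hl1 : 1 ≤ l := hlogX.trans hXl
  set B := Real.log (640 * β) + 4 with hB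
  have hB0 : 0 ≤ Real.log (640 * β) := Real.log_nonneg (by linarith)
  have htl : t ≤ B * l := hlayers.2.trans (by gcongr)
  set a := 2560 * β * t * A with ha
  have ha1 : 1 ≤ a := by
    have h1 : 1 ≤ 2560 * β := by linarith
    exact one_le_mul_of_one_le_of_one_le (one_le_mul_of_one_le_of_one_le h1 ht1) hA1
  have hb0 : 0 ≤ Real.log (10240 * β) := Real.log_nonneg (by linarith)
  have hlog4 : Real.log (4 * t * a) ≤ (Real.log (10240 * β) + 2 * B + 1) * l := by
    have h1 : 4 * t * a = 10240 * β * t ^ 2 * A := by rw [ha]; ring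
    rw [h1, Real.log_mul (by positivity) (by positivity), Real.log_mul (by positivity)
      (by positivity), Real.log_pow]
    have h2 : Real.log t ≤ t := (Real.log_le_sub_one_of_pos (by linarith)).trans (by linarith)
    have h3 : Real.log (10240 * β) ≤ Real.log (10240 * β) * l := le_mul_of_one_le_right hb0 hl1
    push_cast
    linarith
  have hT' : Real.log (4 * t * a / δ) ≤ (Real.log (10240 * β) + 2 * B + 2) * l * L := by
    rw [div_eq_mul_one_div, Real.log_mul (by positivity) (by positivity)]
    have h0 : 0 ≤ (Real.log (10240 * β) + 2 * B + 1) * l := by positivity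
    calc Real.log (4 * t * a) + L ≤ (Real.log (10240 * β) + 2 * B + 1) * l * L + l * L := by
          refine add_le_add (hlog4.trans (le_mul_of_one_le_right h0 hL1))
            (le_mul_of_one_le_left (by linarith) hl1)
      _ = _ := by ring
  have hT1 : 1 ≤ (Real.log (10240 * β) + 2 * B + 2) * l * L :=
    one_le_mul_of_one_le_of_one_le
      (one_le_mul_of_one_le_of_one_le (by linarith) hl1) hL1
  refine (hcount a _ ha1 hT1 hinv hT').trans ?_
  calc 13000 * a ^ 3 * t ^ 3 * ((Real.log (10240 * β) + 2 * B + 2) * l * L) / ρ ^ 2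
      = 13000 * (2560 * β) ^ 3 * t ^ 6 * (Real.log (10240 * β) + 2 * B + 2) * l * G := by
        rw [ha, hGdef]; ring
    _ ≤ 13000 * (2560 * β) ^ 3 * (B * l) ^ 6 * (Real.log (10240 * β) + 2 * B + 2) * l * G := by
        have : 0 ≤ G := by linarith
        gcongr
    _ = sampleConst β * G * l ^ 7 := by rw [sampleConst]; ring

end KMeans

end ReplicableCoreset

end

/-! ### Assembly of the theorem -/

open MeasureTheory

theorem mainTheorem11 :
    ∃ c : ℕ, ∀ β : ℝ, 1 ≤ β → ∃ C : ℝ, 0 < C ∧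
      ∀ (d k : ℕ) (N : Seminorm ℝ (Fin d → ℝ)), IsAdmissibleNorm N →
      ∀ ε ρ δ : ℝ, 0 < ε → ε < 1 → 0 < ρ → ρ < 1 → 0 < δ → δ < ρ / 3 →
      ∀ P : Measure (Fin d → ℝ), IsProbabilityMeasure P → (∀ᵐ x ∂P, x ∈ unitDiamBall N) →
      0 < optCost N k 2 P →
      ∀ lam : ℝ, optCost N k 2 P / (β * (1 + ε)) ≤ lam → lam ≤ (1 + ε) * optCost N k 2 P →
      ∀ ch : ChoiceRule N,
        -- replicability
        IsReplicable (unitDiamBall N) ρ ((kMeansParams k N ε ρ δ lam).rCoreset ch) ∧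
        -- with probability `1 - δ` the output is an `ε`-coreset of small size
        1 - δ ≤ ((Measure.pi fun _ : (kMeansParams k N ε ρ δ lam).SampleIdx => P).prod
            (volume : Measure (kMeansParams k N ε ρ δ lam).Seed)).real
          {z | IsCoreset N k 2 ε P
                (P.map ((kMeansParams k N ε ρ δ lam).rCoreset ch z.1 z.2))
                ((kMeansParams k N ε ρ δ lam).rCoreset ch z.1 z.2 '' unitDiamBall N) ∧
              ((kMeansParams k N ε ρ δ lam).rCoreset ch z.1 z.2 '' unitDiamBall N).Finite ∧
              (((kMeansParams k N ε ρ δ lam).rCoreset ch z.1 z.2 '' unitDiamBall N).ncard : ℝ) ≤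
                C * ((k : ℝ) * 2 ^ (11 * d) * cubeDiam N ^ (d + 2) / ε ^ (2 * d + 2) *
                  Real.log (cubeDiam N ^ 2 / (ε * optCost N k 2 P)))} ∧
        -- sample complexity
        ((kMeansParams k N ε ρ δ lam).sampleComplexity : ℝ) ≤
          C * ((k : ℝ) ^ 3 * 2 ^ (33 * d) * cubeDiam N ^ (3 * d + 6) /
              (ρ ^ 2 * ε ^ (6 * d + 6) * optCost N k 2 P ^ 3) * Real.log (1 / δ)) *
            Real.log ((k : ℝ) ^ 3 * 2 ^ (33 * d) * cubeDiam N ^ (3 * d + 6) /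
              (ρ ^ 2 * ε ^ (6 * d + 6) * optCost N k 2 P ^ 3) * Real.log (1 / δ)) ^ c := by
  refine ⟨7, fun β hβ => ?_⟩
  have hB : 0 ≤ Real.log (640 * β) := Real.log_nonneg (by linarith)
  have hB' : 0 ≤ Real.log (10240 * β) := Real.log_nonneg (by linarith)
  set C₁ : ℝ := (10240 * β + 1) * (Real.log (640 * β) + 4) with hC₁
  have hC₁0 : 0 < C₁ := by positivity
  have hC₂0 : 0 < sampleConst β := by unfold sampleConst; positivity
  refine ⟨C₁ + sampleConst β, by positivity, ?_⟩
  intro d k N hN ε ρ δ hε hε1 hρ hρ1 hδ hδρ P hP hPB hO lam hlam hlam' ch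
  have hd := dim_pos_of_optCost_pos hO
  have hk := card_pos_of_optCost_pos hO
  have hb : NumericBounds β ε (optCost N k 2 P) (cubeDiam N) lam :=
    ⟨hβ, hε, hε1, hO, optCost_le_quarter hN hd hk hPB, one_le_cubeDiam hN hd, hlam, hlam'⟩
  have hvalid := fun i => kMeans_hh_valid hb hk hρ hρ1.le hδ (by linarith) i
  have hγ := kMeans_gamma_pos (ρ := ρ) (δ := δ) hb hk
  refine ⟨?_, ?_, ?_⟩
  · exact Params.isReplicable_rCoreset ch _ (fun l => hvalid _) hρ.le
      (show 3 * δ ≤ ρ by linarith)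
  · refine Params.one_sub_le_measure_good (q := kMeansParams k N ε ρ δ lam)
      (fun l => hvalid _) hδ.le fun z hz => ?_
    have hH := Params.isHeavyTree_heavy (r := z.2) (fun l => hvalid _)
      (kMeans_numLayers_bounds hb).1 hz
    -- By definition `rCoreset` is `toRep` applied to the computed tree of heavy cells.
    refine ⟨?_, hH.finite_image_toRep ch _, ?_⟩
    · refine hH.isCoreset_map_toRep rfl hN hPB ch hk hε hε1 rfl hb.lam_pos hγ hb.one_le_diam ?_
      intro F hFB hFk
      exact hb.lam_le_two_mul.trans
        (mul_le_mul_of_nonneg_left (optCost_le_cost hFB hFk) two_pos.le)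
    · obtain ⟨F, hFB, hFk, hFc⟩ := exists_cost_le_two_mul hN hO
      have h1 := hH.card_leaves_le rfl hN hPB hγ hb.lam_pos
        (lt_of_lt_of_le one_pos hb.one_le_diam) (Finset.card_pos.1 (by omega)) hFB
      rw [hFk] at h1
      refine (Nat.cast_le.2 (hH.ncard_image_toRep_le ch _)).trans (h1.trans ?_)
      refine (kMeans_size_le hb hk hFc).trans ?_
      have h2 := hb.one_le_log
      have h3 : 0 ≤ cubeDiam N := zero_le_one.trans hb.one_le_diam
      gcongr
      linarith
  · have h1 := kMeans_sampleComplexity_le hb hk hρ hρ1.le hδ (by linarith)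
    rw [mul_assoc] at h1 ⊢
    -- Enlarging the constant needs the remaining factor to be nonnegative; this follows from the
    -- bound itself, because a number of samples is nonnegative.
    exact h1.trans (mul_le_mul_of_nonneg_right (by linarith)
      ((mul_nonneg_iff_of_pos_left hC₂0).1 ((Nat.cast_nonneg _).trans h1)))
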